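/- A seller posts a price for one good to a buyer whose value $v$ has an unknown law $F$ on $[0,\infty)$; write $\overline F(p)=\mathbb P_F(v\ge p)$ and $\mathrm{opt}(F)=\sup_{p\ge 0}p\,\overline F(p)$. A law on $[0,\infty)$ is called regular (respectively mhr) if it has a density $f$, except potentially at the maximum of its support, and the virtual value $v-\overline F(v)/f(v)$ (respectively the hazard rate $f(v)/\overline F(v)$) is non-decreasing below that maximum, where a positive number divided by $0$ is read as $\infty$. For $w>0$ and $q\in(0,1)$ let $\mathcal F_0(w,\{q\})$ (respectively $\mathcal F_1(w,\{q\})$) be the set of regular (respectively mhr) laws $F$ on $[0,\infty)$ with finite nonzero mean and $\overline F(w)=q$. For $\alpha\in\{0,1\}$ let $$\mathcal R(\mathcal P_d,\mathcal F_\alpha(w,\{q\}))=\sup_{p\ge 0}\ \inf_{F\in\mathcal F_\alpha(w,\{q\})}\frac{p\,\overline F(p)}{\mathrm{opt}(F)}$$ be the maximin ratio of deterministic prices. A price $p\ge 0$ that attains this supremum is called optimal. **Theorem 2.** Let $w>0$ and $q\in(0,1)$. 1. (Regular, $\alpha=0$.) There is exactly one optimal price $p_d^*(w,q)$, and $$\bigl(p_d^*(w,q),\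 \mathcal R(\mathcal P_d,\mathcal F_0(w,\{q\}))\bigr)=\begin{cases}\left(\dfrac{2w\sqrt q}{1+\sqrt q},\ \dfrac{2\sqrt q}{1+\sqrt q}\right)& q\in(0,\tfrac14],\\[2mm]\left(\dfrac{wq(3-4q)}{1-q},\ \dfrac{3-4q}{4(1-q)}\right)& q\in[\tfrac14,\tfrac12],\\[2mm](w,\ 1-q)& q\in[\tfrac12,1).\end{cases}$$ 2. (Mhr, $\alpha=1$.) Let $W$ be the Lambert function, the inverse of $x\mapsto xe^x$ on $[0,\infty)$, and let $\beta_q(x)=1-\frac{1}{\log(q^{-1})}\bigl(W(x)+\frac1{W(x)}-2\bigr)$. The equation $W\bigl(\frac{1}{\log(q^{-1})}\bigr)W\bigl(\frac eq\bigr)=1$ has a unique solution $q=\hat q$ in $(0,1)$, and $\hat q\in[0.52,0.53]$. For every $w>0$ and $q\in(0,1)$ there is exactly one optimal price $p_d^*(w,q)$, and $$\bigl(p_d^*(w,q),\ \mathcal R(\mathcal P_d,\mathcal F_1(w,\{q\}))\bigr)=\begin{cases}\left(w\,\beta_q\!\left(\frac eq\right),\ \beta_q\!\left(\frac eq\right)\right)&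 q\in(0,\hat q],\\[2mm]\left(w\,\beta_q\!\left(\frac1{\log(q^{-1})}\right),\ \beta_q\!\left(\frac1{\log(q^{-1})}\right)\dfrac qe\,\dfrac{e^{1/W(1/\log(q^{-1}))}}{W(1/\log(q^{-1}))}\right)& q\in[\hat q,e^{-e^{-1}}],\\[2mm]\bigl(w,\ e\,q\log(q^{-1})\bigr)& q\in[e^{-e^{-1}},1).\end{cases}$$ -/

import Mathlib

open MeasureTheory Set
open scoped ENNReal NNReal

noncomputable section

namespace Pricing

/-- `P (v ≥ p)` when the value `v` has law `F`: the probability of a sale at price `p`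
(the complementary cdf of `F`). -/
def saleProb (F : Measure ℝ) (p : ℝ) : ℝ≥0∞ := F (Ici p)

/-- Probability laws on `[0, ∞)`. -/
def IsLaw (F : Measure ℝ) : Prop := IsProbabilityMeasure F ∧ F (Iio 0) = 0

/-- Deterministic mechanisms: Dirac masses at a price `γ ≥ 0`. -/
def deterministicMechanisms : Set (Measure ℝ) :=
  {Ψ | ∃ γ : ℝ, 0 ≤ γ ∧ Ψ = Measure.dirac γ}

/-- Expected revenue of a mechanism `Ψ` (a law of the posted price on `[0, ∞)`) against the value distribution `F`. -/
def revenue (Ψ F : Measure ℝ) : ℝ≥0∞ := ∫⁻ p, ENNReal.ofReal p * saleProb F p ∂Ψ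

/-- The oracle revenue `sup_{p ≥ 0} p * P (v ≥ p)`. -/
def opt (F : Measure ℝ) : ℝ≥0∞ := ⨆ p : ℝ, ⨆ _ : 0 ≤ p, ENNReal.ofReal p * saleProb F p

/-- Performance ratio of the mechanism `Ψ` against `F`. -/
def ratio (Ψ F : Measure ℝ) : ℝ≥0∞ := revenue Ψ F / opt F

/-- Nature's problem: the worst ratio of `Ψ` over the class `𝓕`. -/
def guarantee (Ψ : Measure ℝ) (𝓕 : Set (Measure ℝ)) : ℝ≥0∞ := ⨅ F ∈ 𝓕, ratio Ψ F

/-- The maximin ratio of the mechanism class `𝓟` against the class `𝓕`. -/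
def maximinRatio (𝓟 𝓕 : Set (Measure ℝ)) : ℝ≥0∞ := ⨆ Ψ ∈ 𝓟, guarantee Ψ 𝓕

/-- Posting the price `p ≥ 0` is optimal among all deterministic mechanisms against `𝓕`. -/
def IsOptimalPrice (𝓕 : Set (Measure ℝ)) (p : ℝ) : Prop :=
  0 ≤ p ∧ ∀ p' : ℝ, 0 ≤ p' →
    guarantee (Measure.dirac p') 𝓕 ≤ guarantee (Measure.dirac p) 𝓕

/-- Laws on `[0, ∞)` with finite and nonzero mean whose probability of sale at the price `w`
lies in `I`. -/
def consistentLaws (w : ℝ) (I : Set ℝ) : Set (Measure ℝ) :=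
  {F | IsLaw F ∧ ∫⁻ v, ENNReal.ofReal v ∂F ≠ 0 ∧ ∫⁻ v, ENNReal.ofReal v ∂F ≠ ∞ ∧
    (saleProb F w).toReal ∈ I}

/-- The points of `[0, ∞)` strictly below the maximum of the support of `F`
(all of `[0, ∞)` if the support is unbounded). -/
def belowMax (F : Measure ℝ) : Set ℝ := {v | 0 ≤ v ∧ 0 < F (Ioi v)}

/-- `f` is a density of `F`, except potentially at the maximum of the support of `F`
(where `F` may have an atom). -/
def IsDensityBelowMax (F : Measure ℝ) (f : ℝ → ℝ≥0) : Prop :=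
  Measurable f ∧
    F.restrict (belowMax F) =
      (volume.withDensity fun v => (f v : ℝ≥0∞)).restrict (belowMax F)

/-- Regular laws: a density exists except potentially at the maximum of the support, and the
virtual value `v - P (V ≥ v) / f v` is non-decreasing. A positive number divided by zero is `∞`,
so the virtual value is `-∞` where `f` vanishes. -/
def IsRegular (F : Measure ℝ) : Prop :=
  ∃ f : ℝ → ℝ≥0, IsDensityBelowMax F f ∧
    MonotoneOn (fun v : ℝ => (v : EReal) - ((saleProb F v / (f v : ℝ≥0∞) : ℝ≥0∞) : EReal))
      (belowMax F)

/-- Monotone hazard rate laws: a density exists except potentially at the maximum of the support,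
and the hazard rate `f v / P (V ≥ v)` is non-decreasing. -/
def IsMHR (F : Measure ℝ) : Prop :=
  ∃ f : ℝ → ℝ≥0, IsDensityBelowMax F f ∧
    MonotoneOn (fun v : ℝ => (f v : ℝ≥0∞) / saleProb F v) (belowMax F)

/-- Regular laws whose probability of sale at `w` lies in `I`. -/
def regularClass (w : ℝ) (I : Set ℝ) : Set (Measure ℝ) := {F ∈ consistentLaws w I | IsRegular F}

/-- Monotone hazard rate laws whose probability of sale at `w` lies in `I`. -/
def mhrClass (w : ℝ) (I : Set ℝ) : Set (Measure ℝ) := {F ∈ consistentLaws w I | IsMHR F}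

/-- The Lambert function: the inverse of `x ↦ x * exp x` on `[0, ∞)`. -/
def lambertW (y : ℝ) : ℝ := Function.invFunOn (fun x : ℝ => x * Real.exp x) (Ici 0) y

/-- `lambertW` is indeed a right inverse of `x ↦ x * exp x` on `[0, ∞)`. -/
theorem lambertW_spec {y : ℝ} (hy : 0 ≤ y) :
    0 ≤ lambertW y ∧ lambertW y * Real.exp (lambertW y) = y := by
  have h : ∃ x ∈ Ici (0 : ℝ), (fun x : ℝ => x * Real.exp x) x = y := by
    have hc : ContinuousOn (fun x : ℝ => x * Real.exp x) (Icc 0 y) := by fun_prop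
    have hm : y ∈ Icc ((fun x : ℝ => x * Real.exp x) 0) ((fun x : ℝ => x * Real.exp x) y) := by
      refine ⟨by simpa using hy, ?_⟩
      have := Real.one_le_exp hy
      simpa using le_mul_of_one_le_right hy this
    obtain ⟨x, hx, hxy⟩ := intermediate_value_Icc hy hc hm
    exact ⟨x, hx.1, hxy⟩
  exact ⟨Function.invFunOn_mem h, Function.invFunOn_eq h⟩

/-- `lambertW` is a left inverse of `x ↦ x * exp x` on `[0, ∞)`. -/
theorem lambertW_mul_exp {x : ℝ} (hx : 0 ≤ x) : lambertW (x * Real.exp x) = x := by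
  have hs := lambertW_spec (y := x * Real.exp x) (by positivity)
  rcases lt_trichotomy (lambertW (x * Real.exp x)) x with h | h | h
  · have h1 := mul_lt_mul'' h (Real.exp_lt_exp.2 h) hs.1 (Real.exp_pos _).le
    exact absurd hs.2 h1.ne
  · exact h
  · have h1 := mul_lt_mul'' h (Real.exp_lt_exp.2 h) hx (Real.exp_pos _).le
    exact absurd hs.2 h1.ne'

/-- `β_q(x) = 1 - (W(x) + 1 / W(x) - 2) / log (1 / q)`. -/
def lambertBeta (q x : ℝ) : ℝ :=
  1 - 1 / Real.log (1 / q) * (lambertW x + 1 / lambertW x - 2)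

end Pricing

end

open MeasureTheory Set
open scoped ENNReal NNReal

noncomputable section

namespace Pricing

/-! Write `S p` for the probability of sale at `p`. Regularity makes `1 / S` convex and a monotone
hazard rate makes `log S` concave, as long as `S` is positive. Together with `S 0 = 1` and `S w =
q`, such three-point inequalities control the ratio of a price `w * t`, `t ≤ 1`, against every
benchmark price `w * s`. For `s < t` the worst case is a plateau: all values are at least `w * s`,
and the transformed tail is linear through `w`. For `t ≤ s ≤ 1` monotonicity of `S` suffices. For `s
> 1` the worst case is the tail whose transform is linear from `0` on: zero-based generalized Pareto
for regular laws, exponential for mhr laws. This gives the lower bounds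
`le_ratio_of_mem_regularClass` and `le_ratio_of_mem_mhrClass`.

The same extremal tails, cut off by an atom at a finite maximum, lie in the classes and give
matching upper bounds on the guarantee. A price above `w` has guarantee zero, because the law may
stop at `w`. For `t ≤ 1` there are three upper bounds: `t` itself (plateau close to `w`), the
plateau ratio, and the ratio against the tail based at zero. The guarantee is maximal where two of
them cross, or at `t = 1`. The three regimes are: `t` against the worst plateau; the tail based at
zero against the worst plateau; the tail based at zero alone, with price `w`. Strict monotonicity of
the bounds on either side makes the optimal price unique.

For mhr laws the crossing equations are solved by the Lambert function. The switch between the first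
two regimes reduces to the sign of `switchFun`, a strictly convex function vanishing at `0`, hence
with at most one positive root. -/

/-- The increments of `Φ` are bounded by a second-order error. Over a subdivision into `n + 1` equal
steps the errors telescope to a total of order `1 / (n + 1)`. This replaces differentiation of `S`,
whose density is only measurable. -/
theorem le_of_sub_le_mul_sub {Φ ψ : ℝ → ℝ} {a b : ℝ} (hab : a ≤ b)
    (h : ∀ x y, a ≤ x → x ≤ y → y ≤ b → Φ y - Φ x ≤ (y - x) * (ψ y - ψ x)) : Φ b ≤ Φ a := by
  have key : ∀ n : ℕ, Φ b - Φ a ≤ (b - a) * (ψ b - ψ a) * (1 / ((n : ℝ) + 1)) := by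
    intro n
    have hn : (0 : ℝ) < (n : ℝ) + 1 := by positivity
    have hδ : 0 ≤ (b - a) / ((n : ℝ) + 1) := div_nonneg (by linarith) hn.le
    set δ := (b - a) / ((n : ℝ) + 1) with hδdef
    have hb : a + ((n + 1 : ℕ) : ℝ) * δ = b := by
      rw [hδdef]; push_cast; field_simp; ring
    have ind : ∀ i : ℕ, i ≤ n + 1 →
        Φ (a + i * δ) - Φ a ≤ δ * (ψ (a + i * δ) - ψ a) := by
      intro i
      induction i with
      | zero => intro _; simp
      | succ k ih =>
        intro hk
        have h1 := ih (by omega)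
        have hk' : ((k + 1 : ℕ) : ℝ) ≤ ((n + 1 : ℕ) : ℝ) := by exact_mod_cast hk
        have hle : a + ((k + 1 : ℕ) : ℝ) * δ ≤ b := by
          rw [← hb]; gcongr
        have h2 := h (a + k * δ) (a + ((k + 1 : ℕ) : ℝ) * δ)
          (by have : 0 ≤ (k : ℝ) * δ := by positivity
              linarith) (by push_cast; nlinarith) hle
        have h3 : a + ((k + 1 : ℕ) : ℝ) * δ - (a + k * δ) = δ := by push_cast; ring
        rw [h3] at h2
        nlinarith
    have := ind (n + 1) le_rfl
    rw [hb] at this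
    calc _ ≤ _ := this
      _ = _ := by rw [hδdef]; ring
  have hlim : Filter.Tendsto
      (fun n : ℕ => (b - a) * (ψ b - ψ a) * (1 / ((n : ℝ) + 1))) Filter.atTop (nhds 0) := by
    simpa using (tendsto_one_div_add_atTop_nhds_zero_nat (𝕜 := ℝ)).const_mul
      ((b - a) * (ψ b - ψ a))
  have := ge_of_tendsto' hlim key
  linarith

/-! ### Concavity of `log S` for mhr laws and convexity of `1 / S` for regular laws -/

section Law

variable {F : Measure ℝ}

theorem IsLaw.real_Ici_zero (hF : IsLaw F) : F.real (Ici 0) = 1 := by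
  have := hF.1
  have h : F (Ici 0) = 1 := by
    rw [← compl_Iio, prob_compl_eq_one_sub measurableSet_Iio, hF.2, tsub_zero]
  simp [Measure.real, h]

theorem IsLaw.antitone (hF : IsLaw F) : Antitone fun x => F.real (Ici x) := by
  have := hF.1
  exact fun x y hxy => measureReal_mono (Ici_subset_Ici.2 hxy)

/-- The point `y` may itself be the maximum and carry the atom. Only half-open intervals `[x, y)`
are integrated below, so the atom never enters. -/
theorem mem_belowMax_of_lt {x y : ℝ} (hx : 0 ≤ x) (hxy : x < y) (hy : 0 < F.real (Ici y)) :
    x ∈ belowMax F := by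
  refine ⟨hx, lt_of_lt_of_le ?_ (measure_mono (Ici_subset_Ioi.2 hxy))⟩
  by_contra h
  simp [Measure.real, le_antisymm (not_lt.1 h) bot_le] at hy

theorem real_pos_of_mem_belowMax (hF : IsLaw F) {x : ℝ} (hx : x ∈ belowMax F) :
    0 < F.real (Ici x) := by
  have := hF.1
  exact ENNReal.toReal_pos (hx.2.trans_le (measure_mono Ioi_subset_Ici_self)).ne'
    (measure_ne_top _ _)

theorem measure_Ico_eq_lintegral {f : ℝ → ℝ≥0} (hf : IsDensityBelowMax F f) {x y : ℝ}
    (hx : 0 ≤ x) (hy : 0 < F.real (Ici y)) : F (Ico x y) = ∫⁻ t in Ico x y, f t := by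
  have hsub : Ico x y ⊆ belowMax F := fun t ht => mem_belowMax_of_lt (hx.trans ht.1) ht.2 hy
  have h := congrArg (fun μ : Measure ℝ => μ (Ico x y)) hf.2
  simp only [Measure.restrict_apply measurableSet_Ico, inter_eq_left.2 hsub] at h
  rw [h, withDensity_apply _ measurableSet_Ico]

theorem real_Ici_sub (hF : IsLaw F) {x y : ℝ} (hxy : x ≤ y) :
    F.real (Ici x) - F.real (Ici y) = F.real (Ico x y) := by
  have := hF.1
  rw [← Ico_union_Ici_eq_Ici hxy, measureReal_union _ measurableSet_Ici]
  · ring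
  · exact disjoint_left.2 fun t ht ht' => not_lt.2 ht' ht.2

theorem mul_le_real_Ici_sub (hF : IsLaw F) {f : ℝ → ℝ≥0} (hf : IsDensityBelowMax F f) {x y : ℝ}
    (hx : 0 ≤ x) (hxy : x ≤ y) (hy : 0 < F.real (Ici y)) {a : ℝ}
    (h : ∀ t ∈ Ico x y, a ≤ f t) : (y - x) * a ≤ F.real (Ici x) - F.real (Ici y) := by
  have := hF.1
  rw [real_Ici_sub hF hxy]
  rcases le_total a 0 with ha | ha
  · exact (mul_nonpos_of_nonneg_of_nonpos (by linarith) ha).trans measureReal_nonneg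
  have h1 : ENNReal.ofReal a * volume (Ico x y) ≤ F (Ico x y) := by
    rw [measure_Ico_eq_lintegral hf hx hy, ← setLIntegral_const]
    refine setLIntegral_mono (by exact hf.1.coe_nnreal_ennreal) fun t ht => ?_
    exact ENNReal.ofReal_le_coe.2 (h t ht)
  have h2 := ENNReal.toReal_mono (measure_ne_top _ _) h1
  rw [ENNReal.toReal_mul, ENNReal.toReal_ofReal ha, Real.volume_Ico,
    ENNReal.toReal_ofReal (by linarith)] at h2
  rw [mul_comm]; exact h2

theorem real_Ici_sub_le_mul (hF : IsLaw F) {f : ℝ → ℝ≥0} (hf : IsDensityBelowMax F f) {x y : ℝ}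
    (hx : 0 ≤ x) (hxy : x ≤ y) (hy : 0 < F.real (Ici y)) {a : ℝ} (ha : 0 ≤ a)
    (h : ∀ t ∈ Ico x y, (f t : ℝ) ≤ a) : F.real (Ici x) - F.real (Ici y) ≤ (y - x) * a := by
  have := hF.1
  rw [real_Ici_sub hF hxy]
  have h1 : F (Ico x y) ≤ ENNReal.ofReal a * volume (Ico x y) := by
    rw [measure_Ico_eq_lintegral hf hx hy, ← setLIntegral_const]
    refine setLIntegral_mono measurable_const fun t ht => ?_
    rw [← ENNReal.ofReal_coe_nnreal]
    exact ENNReal.ofReal_le_ofReal (h t ht)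
  have h2 := ENNReal.toReal_mono (by simp [ENNReal.mul_eq_top]) h1
  rw [ENNReal.toReal_mul, ENNReal.toReal_ofReal ha, Real.volume_Ico,
    ENNReal.toReal_ofReal (by linarith)] at h2
  rw [mul_comm]; exact h2

/-- The slope of `log S` is minus the hazard rate, so `m` is the hazard rate at `v`: it bounds the
hazard rate from above to the left of `v` and from below to the right. -/
theorem IsMHR.exists_supporting_line (hF : IsLaw F) (h : IsMHR F) {v : ℝ} (hv : v ∈ belowMax F) :
    ∃ m : ℝ, ∀ x, 0 ≤ x → 0 < F.real (Ici x) →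
      Real.log (F.real (Ici x)) ≤ Real.log (F.real (Ici v)) - m * (x - v) := by
  have := hF.1
  obtain ⟨f, hf, hmono⟩ := h
  have hSv := real_pos_of_mem_belowMax hF hv
  set S : ℝ → ℝ := fun x => F.real (Ici x) with hS
  have hanti : Antitone S := hF.antitone
  have hcross : ∀ s ∈ belowMax F, ∀ t ∈ belowMax F, s ≤ t → (f s : ℝ) * S t ≤ f t * S s := by
    intro s hs t ht hst
    have hSs := real_pos_of_mem_belowMax hF hs
    have hSt := real_pos_of_mem_belowMax hF ht
    have h1 := hmono hs ht hst
    have h2 := ENNReal.toReal_mono (ENNReal.div_ne_top ENNReal.coe_ne_top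
      (ENNReal.toReal_pos_iff.1 hSt).1.ne') h1
    simp only [ENNReal.toReal_div, ENNReal.coe_toReal] at h2
    exact (div_le_div_iff₀ hSs hSt).1 h2
  set m : ℝ := f v / S v with hm
  have hm0 : 0 ≤ m := div_nonneg (f v).2 hSv.le
  have hmul : m * S v = f v := div_mul_cancel₀ _ hSv.ne'
  refine ⟨m, fun x hx hSx => ?_⟩
  rcases le_total x v with hxv | hxv
  -- The linearization of `log` over a step costs the step length times the drop of `S`, up to a
  -- constant. Hence `ψ` is a negative multiple of `S`.
  · have := le_of_sub_le_mul_sub (Φ := fun y => -(Real.log (S y) + m * y))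
      (ψ := fun y => -(m / S v * S y)) hxv ?_
    · linarith
    intro a b hxa hab hbv
    have hSb : 0 < S b := hSv.trans_le (hanti hbv)
    have hSa : 0 < S a := hSb.trans_le (hanti hab)
    have hd : S a - S b ≤ (b - a) * (m * S a) := by
      refine real_Ici_sub_le_mul hF hf (hx.trans hxa) hab hSb (by positivity) fun t ht => ?_
      have htm := mem_belowMax_of_lt (hx.trans (hxa.trans ht.1)) ht.2 hSb
      have h1 := hcross t htm v hv (ht.2.le.trans hbv)
      have h2 : (f t : ℝ) ≤ m * S t := by
        rw [← hmul] at h1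
        exact le_of_mul_le_mul_right (by linarith) hSv
      exact h2.trans (mul_le_mul_of_nonneg_left (hanti ht.1) hm0)
    have hlog : Real.log (S a) - Real.log (S b) ≤ (S a - S b) / S b := by
      rw [← Real.log_div hSa.ne' hSb.ne']
      have := Real.log_le_sub_one_of_pos (div_pos hSa hSb)
      rw [sub_div, div_self hSb.ne']; exact this
    have h3 : (S a - S b) / S b ≤ (b - a) * m + (b - a) * (m / S v) * (S a - S b) := by
      have hk : (S a - S b) / S b ≤ (b - a) * m + (b - a) * m * ((S a - S b) / S b) := by
        rw [div_le_iff₀ hSb]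
        have : ((b - a) * m + (b - a) * m * ((S a - S b) / S b)) * S b
          = (b - a) * (m * S a) := by field_simp; ring
        rw [this]; exact hd
      have hk2 : (b - a) * m * ((S a - S b) / S b) ≤ (b - a) * (m / S v) * (S a - S b) := by
        have e : (b - a) * (m / S v) * (S a - S b) = (b - a) * m * ((S a - S b) / S v) := by ring
        rw [e]
        refine mul_le_mul_of_nonneg_left ?_ (mul_nonneg (by linarith) hm0)
        exact div_le_div_of_nonneg_left (by linarith [hanti hab]) hSv (hanti hbv)
      linarith
    nlinarith
  · have := le_of_sub_le_mul_sub (Φ := fun y => Real.log (S y) + m * y)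
      (ψ := fun y => -(m / S x * S y)) hxv ?_
    · linarith
    intro a b hva hab hbx
    have hSb : 0 < S b := hSx.trans_le (hanti hbx)
    have hSa : 0 < S a := hSb.trans_le (hanti hab)
    have hd : (b - a) * (m * S b) ≤ S a - S b := by
      refine mul_le_real_Ici_sub hF hf (hv.1.trans hva) hab hSb fun t ht => ?_
      have htm := mem_belowMax_of_lt (hv.1.trans (hva.trans ht.1)) ht.2 hSb
      have h1 := hcross v hv t htm (hva.trans ht.1)
      have h2 : m * S t ≤ f t := by
        rw [← hmul] at h1
        exact le_of_mul_le_mul_right (by linarith) hSv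
      exact (mul_le_mul_of_nonneg_left (hanti ht.2.le) hm0).trans h2
    have hlog : Real.log (S b) - Real.log (S a) ≤ -((S a - S b) / S a) := by
      rw [← Real.log_div hSb.ne' hSa.ne']
      have := Real.log_le_sub_one_of_pos (div_pos hSb hSa)
      rw [sub_div, div_self hSa.ne']; linarith
    have h3 : (b - a) * m - (b - a) * (m / S x) * (S a - S b) ≤ (S a - S b) / S a := by
      have hk : (b - a) * m - (b - a) * m * ((S a - S b) / S a) ≤ (S a - S b) / S a := by
        rw [le_div_iff₀ hSa]
        have : ((b - a) * m - (b - a) * m * ((S a - S b) / S a)) * S a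
          = (b - a) * (m * S b) := by field_simp; ring
        rw [this]; exact hd
      have hk2 : (b - a) * m * ((S a - S b) / S a) ≤ (b - a) * (m / S x) * (S a - S b) := by
        have e : (b - a) * (m / S x) * (S a - S b) = (b - a) * m * ((S a - S b) / S x) := by ring
        rw [e]
        refine mul_le_mul_of_nonneg_left ?_ (mul_nonneg (by linarith) hm0)
        exact div_le_div_of_nonneg_left (by linarith [hanti hab]) hSx (hanti (hab.trans hbx))
      linarith
    nlinarith

/-- With `c` the virtual value at `v`, monotonicity gives `f t * (t - c) ≤ S t` to the left of `v`
and the reverse to the right. Hence `S t * (t - c)` is maximal at `v`, which is the supporting line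
of `1 / S` after division. -/
theorem IsRegular.exists_supporting_line (hF : IsLaw F) (h : IsRegular F) {v : ℝ}
    (hv : v ∈ belowMax F) :
    ∃ m : ℝ, ∀ x, 0 ≤ x → 0 < F.real (Ici x) →
      (F.real (Ici v))⁻¹ + m * (x - v) ≤ (F.real (Ici x))⁻¹ := by
  have := hF.1
  obtain ⟨f, hf, hmono⟩ := h
  have hSv := real_pos_of_mem_belowMax hF hv
  set S : ℝ → ℝ := fun x => F.real (Ici x) with hS
  have hanti : Antitone S := hF.antitone
  have hcoe : ∀ t ∈ belowMax F, f t ≠ 0 →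
      (t : EReal) - ((saleProb F t / (f t : ℝ≥0∞) : ℝ≥0∞) : EReal)
        = ((t - S t / f t : ℝ) : EReal) := by
    intro t _ h0
    have e : saleProb F t / (f t : ℝ≥0∞) = ENNReal.ofReal (S t / f t) := by
      rw [ENNReal.ofReal_div_of_pos (by positivity), ENNReal.ofReal_coe_nnreal]
      congr 1
      exact (ENNReal.ofReal_toReal (measure_ne_top _ _)).symm
    rw [e, EReal.coe_ennreal_ofReal, max_eq_left (by positivity), EReal.coe_sub]
  have hbot : ∀ t ∈ belowMax F, f t = 0 →
      (t : EReal) - ((saleProb F t / (f t : ℝ≥0∞) : ℝ≥0∞) : EReal) = ⊥ := by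
    intro t ht h0
    have hs : saleProb F t ≠ 0 :=
      (ENNReal.toReal_pos_iff.1 (real_pos_of_mem_belowMax hF ht)).1.ne'
    rw [h0, ENNReal.coe_zero, ENNReal.div_zero hs, EReal.coe_ennreal_top, EReal.sub_top]
  -- Here the virtual value at `v` is `⊥`, so the density vanishes on `[0, v]`, `S v = 1`, and the
  -- horizontal line supports `1 / S`.
  by_cases h0 : f v = 0
  · have hz : ∀ t, 0 ≤ t → t ≤ v → f t = 0 := by
      intro t ht htv
      have htm : t ∈ belowMax F := ⟨ht, hv.2.trans_le (measure_mono (Ioi_subset_Ioi htv))⟩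
      by_contra hne
      have h1 := hmono htm hv htv
      simp only [hcoe t htm hne, hbot v hv h0] at h1
      exact absurd h1 (not_le.2 (EReal.bot_lt_coe _))
    have h1 : S 0 - S v ≤ (v - 0) * 0 :=
      real_Ici_sub_le_mul hF hf le_rfl hv.1 hSv le_rfl fun t ht => by
        simp [hz t ht.1 ht.2.le]
    have hS0 : S 0 = 1 := hF.real_Ici_zero
    have hSv1 : S v = 1 := le_antisymm (hS0 ▸ hanti hv.1) (by linarith)
    refine ⟨0, fun x hx hSx => ?_⟩
    have : S x ≤ 1 := hS0 ▸ hanti hx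
    rw [show F.real (Ici v) = 1 from hSv1, zero_mul, add_zero, inv_one]
    exact (one_le_inv₀ hSx).2 this
  have hfv : (0 : ℝ) < f v := NNReal.coe_pos.2 (pos_iff_ne_zero.2 h0)
  set c : ℝ := v - S v / f v with hc
  have hvc : 0 < v - c := by rw [hc, sub_sub_cancel]; positivity
  have hright : ∀ t ∈ belowMax F, v ≤ t → S t ≤ f t * (t - c) := by
    intro t ht hvt
    have h1 := hmono hv ht hvt
    by_cases hft : f t = 0
    · simp only [hcoe v hv h0, hbot t ht hft] at h1
      exact absurd h1 (not_le.2 (EReal.bot_lt_coe _))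
    simp only [hcoe v hv h0, hcoe t ht hft, EReal.coe_le_coe_iff] at h1
    have hft' : (0 : ℝ) < f t := NNReal.coe_pos.2 (pos_iff_ne_zero.2 hft)
    have h2 : S t / f t ≤ t - c := by linarith
    rw [div_le_iff₀ hft'] at h2
    linarith
  have hleft : ∀ t ∈ belowMax F, t ≤ v → f t * (t - c) ≤ S t := by
    intro t ht htv
    by_cases hft : f t = 0
    · simp [hft]; positivity
    have h1 := hmono ht hv htv
    simp only [hcoe v hv h0, hcoe t ht hft, EReal.coe_le_coe_iff] at h1
    have hft' : (0 : ℝ) < f t := NNReal.coe_pos.2 (pos_iff_ne_zero.2 hft)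
    have h2 : t - c ≤ S t / f t := by linarith
    rw [le_div_iff₀ hft'] at h2
    linarith
  have hmain : ∀ x, 0 ≤ x → 0 < S x → S x * (x - c) ≤ S v * (v - c) := by
    intro x hx hSx
    rcases le_total x v with hxv | hxv
    · rcases le_or_gt (x - c) 0 with hxc | hxc
      · exact (mul_nonpos_of_nonneg_of_nonpos hSx.le hxc).trans (by positivity)
      have := le_of_sub_le_mul_sub (Φ := fun y => -(S y * (y - c)))
        (ψ := fun y => -(S y)) hxv ?_
      · linarith
      intro a b hxa hab hbv
      have hac : 0 < a - c := by linarith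
      have hSb : 0 < S b := hSv.trans_le (hanti hbv)
      have hSa : 0 < S a := hSb.trans_le (hanti hab)
      have hd : S a - S b ≤ (b - a) * (S a / (a - c)) := by
        refine real_Ici_sub_le_mul hF hf (hx.trans hxa) hab hSb (by positivity) fun t ht => ?_
        have htm := mem_belowMax_of_lt (hx.trans (hxa.trans ht.1)) ht.2 hSb
        have h1 := hleft t htm (ht.2.le.trans hbv)
        rw [le_div_iff₀ hac]
        calc (f t : ℝ) * (a - c) ≤ f t * (t - c) := by gcongr; exact ht.1
          _ ≤ S t := h1
          _ ≤ S a := hanti ht.1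
      have hd2 : (S a - S b) * (a - c) ≤ (b - a) * S a := by
        have := mul_le_mul_of_nonneg_right hd hac.le
        rwa [mul_assoc, div_mul_cancel₀ _ hac.ne'] at this
      nlinarith
    · have := le_of_sub_le_mul_sub (Φ := fun y => S y * (y - c))
        (ψ := fun y => -(S y)) hxv ?_
      · linarith
      intro a b hva hab hbx
      have hac : 0 < a - c := by linarith
      have hbc : 0 < b - c := by linarith
      have hSb : 0 < S b := hSx.trans_le (hanti hbx)
      have hd : (b - a) * (S b / (b - c)) ≤ S a - S b := by
        refine mul_le_real_Ici_sub hF hf (hv.1.trans hva) hab hSb fun t ht => ?_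
        have htm := mem_belowMax_of_lt (hv.1.trans (hva.trans ht.1)) ht.2 hSb
        have h1 := hright t htm (hva.trans ht.1)
        rw [div_le_iff₀ hbc]
        calc S b ≤ S t := hanti ht.2.le
          _ ≤ f t * (t - c) := h1
          _ ≤ f t * (b - c) := by gcongr; exact ht.2.le
      have hd2 : (b - a) * S b ≤ (S a - S b) * (b - c) := by
        have := mul_le_mul_of_nonneg_right hd hbc.le
        rwa [mul_assoc, div_mul_cancel₀ _ hbc.ne'] at this
      nlinarith
  refine ⟨1 / (S v * (v - c)), fun x hx hSx => ?_⟩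
  have h1 := hmain x hx hSx
  have hpos : 0 < S v * (v - c) := by positivity
  have e : (S v)⁻¹ + 1 / (S v * (v - c)) * (x - v) = (x - c) / (S v * (v - c)) := by
    field_simp; ring
  change (S v)⁻¹ + 1 / (S v * (v - c)) * (x - v) ≤ (S x)⁻¹
  rw [e, div_le_iff₀ hpos, ← div_eq_inv_mul, le_div_iff₀ hSx]
  linarith

theorem IsMHR.log_three_point (hF : IsLaw F) (h : IsMHR F) {u v z : ℝ} (hu : 0 ≤ u)
    (huv : u ≤ v) (hvz : v < z) (hz : 0 < F.real (Ici z)) :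
    (z - v) * Real.log (F.real (Ici u)) + (v - u) * Real.log (F.real (Ici z))
      ≤ (z - u) * Real.log (F.real (Ici v)) := by
  obtain ⟨m, hm⟩ := h.exists_supporting_line hF (mem_belowMax_of_lt (hu.trans huv) hvz hz)
  have h1 := hm u hu (hz.trans_le (hF.antitone (huv.trans hvz.le)))
  have h2 := hm z (hu.trans (huv.trans hvz.le)) hz
  nlinarith [mul_le_mul_of_nonneg_left h1 (sub_nonneg.2 hvz.le),
    mul_le_mul_of_nonneg_left h2 (sub_nonneg.2 huv)]

theorem IsRegular.inv_three_point (hF : IsLaw F) (h : IsRegular F) {u v z : ℝ} (hu : 0 ≤ u)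
    (huv : u ≤ v) (hvz : v < z) (hz : 0 < F.real (Ici z)) :
    (z - u) * (F.real (Ici v))⁻¹
      ≤ (z - v) * (F.real (Ici u))⁻¹ + (v - u) * (F.real (Ici z))⁻¹ := by
  obtain ⟨m, hm⟩ := h.exists_supporting_line hF (mem_belowMax_of_lt (hu.trans huv) hvz hz)
  have h1 := hm u hu (hz.trans_le (hF.antitone (huv.trans hvz.le)))
  have h2 := hm z (hu.trans (huv.trans hvz.le)) hz
  nlinarith [mul_le_mul_of_nonneg_left h1 (sub_nonneg.2 hvz.le),
    mul_le_mul_of_nonneg_left h2 (sub_nonneg.2 huv)]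

end Law

end Pricing

namespace Pricing

/-! ### Lower bounds on the ratio of a price, valid for the whole class -/

section Bounds

variable {F : Measure ℝ}

theorem revenue_dirac (p : ℝ) : revenue (Measure.dirac p) F = ENNReal.ofReal p * saleProb F p :=
  lintegral_dirac _ _

theorem IsLaw.ofReal_real_Ici (hF : IsLaw F) (p : ℝ) :
    ENNReal.ofReal (F.real (Ici p)) = saleProb F p := by
  have := hF.1
  exact ENNReal.ofReal_toReal (measure_ne_top _ _)

theorem IsLaw.ofReal_mul_saleProb (hF : IsLaw F) {p : ℝ} (hp : 0 ≤ p) :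
    ENNReal.ofReal p * saleProb F p = ENNReal.ofReal (p * F.real (Ici p)) := by
  rw [ENNReal.ofReal_mul hp, hF.ofReal_real_Ici]

theorem le_ratio_dirac (hF : IsLaw F) {G p w : ℝ} (hG : 0 ≤ G) (hp : 0 ≤ p) (hw : 0 < w)
    (hSw : 0 < F.real (Ici w)) (h : ∀ r, 0 ≤ r → G * (r * F.real (Ici r)) ≤ p * F.real (Ici p)) :
    ENNReal.ofReal G ≤ ratio (Measure.dirac p) F := by
  have hopt : opt F ≠ 0 := by
    have h1 : ENNReal.ofReal w * saleProb F w ≤ opt F := le_iSup₂_of_le w hw.le le_rfl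
    rw [hF.ofReal_mul_saleProb hw.le] at h1
    exact ((ENNReal.ofReal_pos.2 (by positivity)).trans_le h1).ne'
  rw [ratio, revenue_dirac, hF.ofReal_mul_saleProb hp]
  rw [ENNReal.le_div_iff_mul_le (Or.inl hopt) (Or.inr ENNReal.ofReal_ne_top), opt,
    ENNReal.mul_iSup]
  refine iSup_le fun r => ?_
  rw [ENNReal.mul_iSup]
  refine iSup_le fun hr => ?_
  rw [hF.ofReal_mul_saleProb hr, ← ENNReal.ofReal_mul hG]
  exact ENNReal.ofReal_le_ofReal (h r hr)

/-- One law and one benchmark price `x` suffice for an upper bound, since `opt F` is at least the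
revenue at `x`. -/
theorem guarantee_dirac_le {𝓕 : Set (Measure ℝ)} (hF : IsLaw F) (hmem : F ∈ 𝓕) {p x : ℝ}
    (hp : 0 ≤ p) (hx : 0 < x) (hSx : 0 < F.real (Ici x)) :
    guarantee (Measure.dirac p) 𝓕
      ≤ ENNReal.ofReal (p * F.real (Ici p) / (x * F.real (Ici x))) := by
  refine (iInf₂_le F hmem).trans ?_
  rw [ratio, revenue_dirac, hF.ofReal_mul_saleProb hp, ENNReal.ofReal_div_of_pos (by positivity)]
  refine ENNReal.div_le_div_left ?_ _
  rw [← hF.ofReal_mul_saleProb hx.le]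
  exact le_iSup₂_of_le x hx.le le_rfl

/-- Each hypothesis on `G` handles one range of benchmark prices `w * s`: `hlow` compares `G` with
the plateau ratio for `s < t`, `hGt` serves `t ≤ s ≤ 1`, and `hhigh` serves `s > 1`, where it
compares `G` with the limiting ratio against the Pareto tail based at zero. -/
theorem le_ratio_of_mem_regularClass {w q t G : ℝ} (hw : 0 < w) (hq : 0 < q) (ht : 0 < t)
    (ht1 : t ≤ 1) (hG : 0 ≤ G) (hGt : G ≤ t)
    (hhigh : G * (q + (1 - q) * t) ≤ (1 - q) * t)
    (hlow : ∀ s, 0 ≤ s → s < t → G * s * ((1 - t) * q + (t - s)) ≤ q * t * (1 - s))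
    (hF : F ∈ regularClass w {q}) : ENNReal.ofReal G ≤ ratio (Measure.dirac (w * t)) F := by
  obtain ⟨⟨hL, -, -, hSw⟩, hreg⟩ := hF
  replace hSw : F.real (Ici w) = q := hSw
  have hS0 := hL.real_Ici_zero
  have hanti := hL.antitone
  have hSw0 : 0 < F.real (Ici w) := hSw ▸ hq
  refine le_ratio_dirac hL hG (by positivity) hw hSw0 fun r hr => ?_
  obtain ⟨s, rfl⟩ : ∃ s, r = w * s := ⟨r / w, by field_simp⟩
  have hs : 0 ≤ s := nonneg_of_mul_nonneg_right hr hw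
  have hSp : 0 < F.real (Ici (w * t)) :=
    hSw0.trans_le (hanti (by nlinarith))
  rcases (measureReal_nonneg (μ := F) (s := Ici (w * s))).eq_or_lt with h0 | hSr
  · rw [← h0]; simp only [mul_zero]; positivity
  suffices h : G * s * (F.real (Ici (w * t)))⁻¹ ≤ t * (F.real (Ici (w * s)))⁻¹ by
    rw [← div_eq_mul_inv, ← div_eq_mul_inv, div_le_div_iff₀ hSp hSr] at h
    nlinarith
  have hSr1 : 1 ≤ (F.real (Ici (w * s)))⁻¹ :=
    (one_le_inv₀ hSr).2 (hS0 ▸ hanti hr)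
  have h01 : (F.real (Ici (0 : ℝ)))⁻¹ = 1 := by rw [hS0, inv_one]
  have hpq : q * (F.real (Ici (w * t)))⁻¹ ≤ q + (1 - q) * t := by
    -- The three-point inequality needs its middle point strictly below the last one, because an
    -- atom at `w` is allowed; `t = 1` is settled by `S w = q`.
    rcases ht1.eq_or_lt with rfl | ht1
    · rw [mul_one, hSw, mul_inv_cancel₀ hq.ne']; linarith
    have h1 := hreg.inv_three_point hL le_rfl (by positivity) (by nlinarith : w * t < w) hSw0
    rw [hSw, h01] at h1
    have h2 : w * (q * (F.real (Ici (w * t)))⁻¹) ≤ w * (q + (1 - q) * t) := by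
      have := mul_le_mul_of_nonneg_left h1 hq.le
      have e : q * ((w - w * t) * 1 + (w * t - 0) * q⁻¹) = w * (q + (1 - q) * t) := by
        field_simp; ring
      rw [e] at this; linarith
    exact le_of_mul_le_mul_left h2 hw
  rcases lt_or_ge s t with hst | hst
  · have hA := hlow s hs hst
    rcases ht1.eq_or_lt with rfl | ht1
    · rw [mul_one, hSw]
      have h1 : G * s ≤ q := by
        have : 0 < 1 - s := by linarith
        nlinarith
      calc G * s * q⁻¹ ≤ 1 := by rw [← div_eq_mul_inv, div_le_one hq]; exact h1
        _ ≤ _ := by linarith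
    have h1 := hreg.inv_three_point hL hr (by nlinarith : w * s ≤ w * t)
      (by nlinarith : w * t < w) hSw0
    rw [hSw] at h1
    set a := (F.real (Ici (w * t)))⁻¹
    set b := (F.real (Ici (w * s)))⁻¹
    have h2 : (1 - s) * (q * a) ≤ (1 - t) * q * b + (t - s) := by
      have := mul_le_mul_of_nonneg_left h1 hq.le
      have e : q * ((w - w * t) * b + (w * t - w * s) * q⁻¹)
          = w * ((1 - t) * q * b + (t - s)) := by field_simp
      rw [e] at this
      refine le_of_mul_le_mul_left ?_ hw
      linarith
    have h3 : G * s * ((1 - s) * (q * a)) ≤ q * t * (1 - s) * b := by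
      have h4 := mul_le_mul_of_nonneg_left h2 (mul_nonneg hG hs)
      have h5 : 0 ≤ G * s * (t - s) := mul_nonneg (mul_nonneg hG hs) (by linarith)
      nlinarith
    have h6 : 0 < q * (1 - s) := mul_pos hq (by linarith)
    refine le_of_mul_le_mul_left ?_ h6
    linarith
  rcases le_or_gt s 1 with hs1 | hs1
  · have hle : F.real (Ici (w * s)) ≤ F.real (Ici (w * t)) := hanti (by nlinarith)
    have h1 := inv_anti₀ hSr hle
    have h2 : G * s ≤ t := by nlinarith
    exact mul_le_mul h2 h1 (by positivity) ht.le
  · have h1 := hreg.inv_three_point hL le_rfl hw.le (by nlinarith : w < w * s) hSr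
    rw [hSw, h01] at h1
    set a := (F.real (Ici (w * t)))⁻¹
    set b := (F.real (Ici (w * s)))⁻¹
    -- Convexity at `0`, `w`, `w * s` bounds the revenue beyond `w` by `w * q / (1 - q)`.
    have h2 : (1 - q) * s ≤ q * b := by
      have := mul_le_mul_of_nonneg_left h1 hq.le
      have e : q * ((w * s - 0) * q⁻¹) = w * s := by field_simp; ring
      rw [e] at this
      have h3 : w * s ≤ w * (q * (s - 1 + b)) := by linarith
      have h4 := le_of_mul_le_mul_left h3 hw
      linarith
    refine le_of_mul_le_mul_left ?_ hq
    have h5 := mul_le_mul_of_nonneg_left hpq (mul_nonneg hG hs)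
    have h6 := mul_le_mul_of_nonneg_left hhigh hs
    have h7 := mul_le_mul_of_nonneg_left h2 ht.le
    linarith

/-- Same division of benchmark prices as in the regular case, with `q = exp (-l)`. Concavity of `log
S` through `0` and `w` puts `S` above `exp (-(l * t))` before `w` and below `exp (-(l * s))` after
it. -/
theorem le_ratio_of_mem_mhrClass {w l t G : ℝ} (hw : 0 < w) (ht : 0 < t)
    (ht1 : t ≤ 1) (hG : 0 ≤ G) (hGt : G ≤ t)
    (hhigh : ∀ s, 1 ≤ s → G * s * Real.exp (-(l * s)) ≤ t * Real.exp (-(l * t)))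
    (hlow : ∀ s, 0 ≤ s → s < t → G * s ≤ t * Real.exp (-(l * (t - s) / (1 - s))))
    (hF : F ∈ mhrClass w {Real.exp (-l)}) :
    ENNReal.ofReal G ≤ ratio (Measure.dirac (w * t)) F := by
  obtain ⟨⟨hL, -, -, hSw⟩, hmhr⟩ := hF
  replace hSw : F.real (Ici w) = Real.exp (-l) := hSw
  have hS0 := hL.real_Ici_zero
  have hanti := hL.antitone
  have hSw0 : 0 < F.real (Ici w) := hSw ▸ Real.exp_pos _
  refine le_ratio_dirac hL hG (by positivity) hw hSw0 fun r hr => ?_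
  obtain ⟨s, rfl⟩ : ∃ s, r = w * s := ⟨r / w, by field_simp⟩
  have hs : 0 ≤ s := nonneg_of_mul_nonneg_right hr hw
  have hSp : 0 < F.real (Ici (w * t)) :=
    hSw0.trans_le (hanti (by nlinarith))
  rcases (measureReal_nonneg (μ := F) (s := Ici (w * s))).eq_or_lt with h0 | hSr
  · rw [← h0]; simp only [mul_zero]; positivity
  suffices h : G * s * F.real (Ici (w * s)) ≤ t * F.real (Ici (w * t)) by
    have := mul_le_mul_of_nonneg_left h hw.le
    linarith
  have hSr1 : F.real (Ici (w * s)) ≤ 1 := hS0 ▸ hanti hr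
  have h01 : Real.log (F.real (Ici (0 : ℝ))) = 0 := by rw [hS0, Real.log_one]
  have hp : Real.exp (-(l * t)) ≤ F.real (Ici (w * t)) := by
    rcases ht1.eq_or_lt with rfl | ht1
    · rw [mul_one, mul_one, hSw]
    have h1 := hmhr.log_three_point hL le_rfl (by positivity) (by nlinarith : w * t < w) hSw0
    rw [hSw, h01, Real.log_exp] at h1
    rw [← Real.le_log_iff_exp_le hSp]
    refine le_of_mul_le_mul_left ?_ hw
    linarith
  rcases lt_or_ge s t with hst | hst
  · have hs1 : 0 < 1 - s := by linarith
    have h2 : F.real (Ici (w * s)) * Real.exp (-(l * (t - s) / (1 - s)))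
        ≤ F.real (Ici (w * t)) := by
      rcases ht1.eq_or_lt with rfl | ht1
      · rw [mul_one, hSw, mul_div_assoc, div_self hs1.ne', mul_one]
        exact mul_le_of_le_one_left (Real.exp_pos _).le hSr1
      have h1 := hmhr.log_three_point hL hr (by nlinarith : w * s ≤ w * t)
        (by nlinarith : w * t < w) hSw0
      rw [hSw, Real.log_exp] at h1
      rw [← Real.log_le_log_iff (by positivity) hSp, Real.log_mul hSr.ne' (Real.exp_pos _).ne',
        Real.log_exp]
      have h3 : Real.log (F.real (Ici (w * s))) ≤ 0 := Real.log_nonpos hSr.le hSr1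
      set a := Real.log (F.real (Ici (w * t)))
      set b := Real.log (F.real (Ici (w * s)))
      have h4 : (1 - t) * b - l * (t - s) ≤ (1 - s) * a := by
        refine le_of_mul_le_mul_left ?_ hw
        linarith
      have h5 : (1 - s) * (b + -(l * (t - s) / (1 - s))) = (1 - s) * b - l * (t - s) := by
        field_simp; ring
      refine le_of_mul_le_mul_left ?_ hs1
      rw [h5]
      nlinarith
    calc G * s * F.real (Ici (w * s))
        ≤ t * Real.exp (-(l * (t - s) / (1 - s))) * F.real (Ici (w * s)) := by
          exact mul_le_mul_of_nonneg_right (hlow s hs hst) hSr.le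
      _ = t * (F.real (Ici (w * s)) * Real.exp (-(l * (t - s) / (1 - s)))) := by ring
      _ ≤ _ := by gcongr
  rcases le_or_gt s 1 with hs1 | hs1
  · have hle : F.real (Ici (w * s)) ≤ F.real (Ici (w * t)) := hanti (by nlinarith)
    have h2 : G * s ≤ t := by nlinarith
    exact mul_le_mul h2 hle hSr.le ht.le
  · have h1 := hmhr.log_three_point hL le_rfl hw.le (by nlinarith : w < w * s) hSr
    rw [hSw, h01, Real.log_exp] at h1
    have h2 : F.real (Ici (w * s)) ≤ Real.exp (-(l * s)) := by
      rw [← Real.log_le_iff_le_exp hSr]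
      refine le_of_mul_le_mul_left ?_ hw
      linarith
    calc G * s * F.real (Ici (w * s)) ≤ G * s * Real.exp (-(l * s)) := by gcongr
      _ ≤ t * Real.exp (-(l * t)) := hhigh s hs1.le
      _ ≤ _ := by gcongr

theorem isOptimalPrice_iff_and_maximinRatio {𝓕 : Set (Measure ℝ)} {p₀ G : ℝ} (hp₀ : 0 ≤ p₀)
    (hlow : ∀ F ∈ 𝓕, ENNReal.ofReal G ≤ ratio (Measure.dirac p₀) F)
    (hup : guarantee (Measure.dirac p₀) 𝓕 ≤ ENNReal.ofReal G)
    (hlt : ∀ p, 0 ≤ p → p ≠ p₀ → guarantee (Measure.dirac p) 𝓕 < ENNReal.ofReal G) :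
    (∀ p, IsOptimalPrice 𝓕 p ↔ p = p₀) ∧
      maximinRatio deterministicMechanisms 𝓕 = ENNReal.ofReal G := by
  have heq : guarantee (Measure.dirac p₀) 𝓕 = ENNReal.ofReal G :=
    le_antisymm hup (le_iInf₂ hlow)
  have hle : ∀ p, 0 ≤ p → guarantee (Measure.dirac p) 𝓕 ≤ ENNReal.ofReal G := fun p hp => by
    rcases eq_or_ne p p₀ with rfl | h
    · exact hup
    · exact (hlt p hp h).le
  refine ⟨fun p => ⟨fun h => ?_, ?_⟩, le_antisymm ?_ ?_⟩
  · by_contra hne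
    exact absurd (h.2 p₀ hp₀) (not_le.2 (heq ▸ hlt p h.1 hne))
  · rintro rfl
    exact ⟨hp₀, fun p hp => heq ▸ hle p hp⟩
  · refine iSup₂_le ?_
    rintro _ ⟨p, hp, rfl⟩
    exact hle p hp
  · rw [← heq]
    exact le_iSup₂_of_le _ ⟨p₀, hp₀, rfl⟩ le_rfl

end Bounds

end Pricing

/-! ### Laws with a plateau, a prescribed tail and an atom at the maximum -/

namespace Pricing

/-- The density that vanishes below `r` and is `d` from `r` on. -/
def plateauDensity (d : ℝ → ℝ) (r : ℝ) : ℝ → ℝ≥0 := (Ici r).indicator fun v => (d v).toNNReal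

/-- The law with density `d` on `[r, T)` and an atom of mass `a` at `T`. -/
def plateauLaw (d : ℝ → ℝ) (r T a : ℝ) : Measure ℝ :=
  (volume.withDensity fun v => (plateauDensity d r v : ℝ≥0∞)).restrict (Ico 0 T) +
    ENNReal.ofReal a • Measure.dirac T

/-- `D` is the probability of sale on `[r, T]` of a law with density `d` on `[r, T)`, whose
values lie in `[r, T]`. -/
structure IsTail (D d : ℝ → ℝ) (r T : ℝ) : Prop where
  nonneg : 0 ≤ r
  lt : r < T
  left : D r = 1
  right : 0 < D T
  deriv : ∀ v ∈ Icc r T, HasDerivAt D (-d v) v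
  density_nonneg : ∀ v ∈ Icc r T, 0 ≤ d v
  measurable : Measurable d
  continuousOn : ContinuousOn d (Icc r T)

namespace IsTail

variable {D d : ℝ → ℝ} {r T : ℝ}

theorem lintegral_Ico (h : IsTail D d r T) {v : ℝ} (hv : v ∈ Icc r T) :
    ∫⁻ t in Ico v T, ENNReal.ofReal (d t) = ENNReal.ofReal (D v - D T) := by
  have hsub : Icc v T ⊆ Icc r T := Icc_subset_Icc_left hv.1
  have hint : IntervalIntegrable d volume v T :=
    (h.continuousOn.mono (by rwa [uIcc_of_le hv.2])).intervalIntegrable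
  have hI : IntegrableOn d (Ioc v T) := (intervalIntegrable_iff_integrableOn_Ioc_of_le hv.2).1 hint
  rw [restrict_Ico_eq_restrict_Ioc, ← ofReal_integral_eq_lintegral_ofReal hI]
  · congr 1
    rw [← intervalIntegral.integral_of_le hv.2]
    have := intervalIntegral.integral_eq_sub_of_hasDerivAt (f := D) (f' := fun t => -d t)
      (a := v) (b := T) (fun t ht => h.deriv t (hsub (by rwa [uIcc_of_le hv.2] at ht))) hint.neg
    rw [intervalIntegral.integral_neg] at this
    linarith
  · refine (ae_restrict_iff' measurableSet_Ioc).2 (ae_of_all _ fun t ht => ?_)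
    exact h.density_nonneg t (hsub (Ioc_subset_Icc_self ht))

theorem saleProb_of_le (h : IsTail D d r T) {v : ℝ} (hv : 0 ≤ v) (hvT : v ≤ T) :
    saleProb (plateauLaw d r T (D T)) v = ENNReal.ofReal (D (max v r)) := by
  have hm : max v r ∈ Icc r T := ⟨le_max_right _ _, max_le hvT h.lt.le⟩
  have e1 : Ici v ∩ Ico 0 T = Ico v T := by
    ext t; simp only [mem_inter_iff, mem_Ici, mem_Ico]
    constructor
    · rintro ⟨a, b, c⟩; exact ⟨a, c⟩
    · rintro ⟨a, b⟩; exact ⟨a, hv.trans a, b⟩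
  have e2 : Ici r ∩ Ico v T = Ico (max v r) T := by
    ext t; simp only [mem_inter_iff, mem_Ici, mem_Ico, max_le_iff]; tauto
  have e3 : ∀ t, ((plateauDensity d r t : ℝ≥0) : ℝ≥0∞)
      = (Ici r).indicator (fun v => ENNReal.ofReal (d v)) t := by
    intro t
    simp only [plateauDensity, ENNReal.coe_indicator]
    rfl
  have hnn : 0 ≤ D (max v r) - D T := by
    by_contra hneg
    have hne : D (max v r) ≠ D T := by intro he; simp [he] at hneg
    have hlt : max v r < T := lt_of_le_of_ne hm.2 fun he => hne (by rw [he])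
    obtain ⟨c, hc, hc'⟩ := exists_hasDerivAt_eq_slope D (fun t => -d t) hlt
      (fun t ht => (h.deriv t ⟨hm.1.trans ht.1, ht.2⟩).continuousAt.continuousWithinAt)
      (fun t ht => h.deriv t ⟨hm.1.trans ht.1.le, ht.2.le⟩)
    have h1 := h.density_nonneg c ⟨hm.1.trans hc.1.le, hc.2.le⟩
    have h2 : 0 < (D T - D (max v r)) / (T - max v r) := div_pos (by linarith) (by linarith)
    linarith
  rw [saleProb, plateauLaw, Measure.add_apply, Measure.restrict_apply measurableSet_Ici, e1,
    withDensity_apply _ measurableSet_Ico, Measure.smul_apply, Measure.dirac_apply' _ measurableSet_Ici]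
  simp only [e3]
  rw [setLIntegral_indicator measurableSet_Ici, e2, h.lintegral_Ico hm,
    indicator_of_mem (show T ∈ Ici v from hvT)]
  simp only [Pi.one_apply, smul_eq_mul, mul_one]
  rw [← ENNReal.ofReal_add hnn h.right.le, sub_add_cancel]

theorem plateauLaw_Ioi (d : ℝ → ℝ) (r T a : ℝ) : plateauLaw d r T a (Ioi T) = 0 := by
  have e : Ioi T ∩ Ico 0 T = ∅ := by
    ext t; simp only [mem_inter_iff, mem_Ioi, mem_Ico, mem_empty_iff_false, iff_false]
    rintro ⟨h1, -, h2⟩; exact lt_asymm h1 h2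
  rw [plateauLaw, Measure.add_apply, Measure.restrict_apply measurableSet_Ioi, e,
    Measure.smul_apply, Measure.dirac_apply' _ measurableSet_Ioi]
  simp

theorem isLaw (h : IsTail D d r T) : IsLaw (plateauLaw d r T (D T)) := by
  have h0 : plateauLaw d r T (D T) (Iio 0) = 0 := by
    have e : Iio 0 ∩ Ico 0 T = ∅ := by
      ext t; simp only [mem_inter_iff, mem_Iio, mem_Ico, mem_empty_iff_false, iff_false]
      rintro ⟨h1, h2, -⟩; linarith
    have hT : T ∉ Iio (0 : ℝ) := not_lt.2 (h.nonneg.trans h.lt.le)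
    rw [plateauLaw, Measure.add_apply, Measure.restrict_apply measurableSet_Iio, e,
      Measure.smul_apply, Measure.dirac_apply' _ measurableSet_Iio, indicator_of_notMem hT]
    simp
  refine ⟨⟨?_⟩, h0⟩
  have h1 := h.saleProb_of_le le_rfl (h.nonneg.trans h.lt.le)
  rw [max_eq_right h.nonneg, h.left, ENNReal.ofReal_one] at h1
  rw [← Iio_union_Ici (a := (0 : ℝ)),
    measure_union (Iio_disjoint_Ici le_rfl) measurableSet_Ici, h0, zero_add]
  exact h1

theorem tail_pos (h : IsTail D d r T) {v : ℝ} (hv : v ∈ Icc r T) : 0 < D v := by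
  have h1 := h.saleProb_of_le (h.nonneg.trans hv.1) hv.2
  have h2 := h.saleProb_of_le (h.nonneg.trans h.lt.le) le_rfl
  rw [max_eq_left hv.1] at h1
  rw [max_eq_left h.lt.le] at h2
  have h3 : saleProb (plateauLaw d r T (D T)) T ≤ saleProb (plateauLaw d r T (D T)) v :=
    measure_mono (Ici_subset_Ici.2 hv.2)
  rw [h1, h2] at h3
  exact ENNReal.ofReal_pos.1 ((ENNReal.ofReal_pos.2 h.right).trans_le h3)

theorem real_Ici_of_le (h : IsTail D d r T) {v : ℝ} (hv : 0 ≤ v) (hvT : v ≤ T) :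
    (plateauLaw d r T (D T)).real (Ici v) = D (max v r) := by
  have h1 := congrArg ENNReal.toReal (h.saleProb_of_le hv hvT)
  rwa [ENNReal.toReal_ofReal
    (h.tail_pos ⟨le_max_right _ _, max_le hvT h.lt.le⟩).le] at h1

theorem real_Ici_of_lt (d : ℝ → ℝ) (r T a : ℝ) {v : ℝ} (hv : T < v) :
    (plateauLaw d r T a).real (Ici v) = 0 := by
  rw [Measure.real, measure_mono_null (Ici_subset_Ioi.2 hv) (plateauLaw_Ioi d r T a)]
  rfl

theorem belowMax_eq (h : IsTail D d r T) : belowMax (plateauLaw d r T (D T)) = Ico 0 T := by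
  ext v
  constructor
  · rintro ⟨h0, h1⟩
    refine ⟨h0, ?_⟩
    by_contra hv
    exact h1.ne' (measure_mono_null (Ioi_subset_Ioi (not_lt.1 hv)) (plateauLaw_Ioi d r T _))
  · rintro ⟨h0, h1⟩
    refine ⟨h0, lt_of_lt_of_le ?_ (measure_mono (Ici_subset_Ioi.2 h1))⟩
    have := h.saleProb_of_le (h.nonneg.trans h.lt.le) le_rfl
    rw [max_eq_left h.lt.le] at this
    exact (ENNReal.ofReal_pos.2 h.right).trans_le this.ge

theorem isDensityBelowMax (h : IsTail D d r T) :
    IsDensityBelowMax (plateauLaw d r T (D T)) (plateauDensity d r) := by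
  refine ⟨h.measurable.real_toNNReal.indicator measurableSet_Ici, ?_⟩
  have hT : T ∉ Ico 0 T := fun hh => lt_irrefl _ hh.2
  rw [h.belowMax_eq, plateauLaw, Measure.restrict_add, Measure.restrict_restrict measurableSet_Ico,
    inter_self, Measure.restrict_smul, restrict_dirac' measurableSet_Ico, if_neg hT, smul_zero,
    add_zero]

theorem mem_consistentLaws (h : IsTail D d r T) {w : ℝ} (hrw : r ≤ w) (hw : 0 < w) (hwT : w ≤ T) :
    plateauLaw d r T (D T) ∈ consistentLaws w {D w} := by
  have hL := h.isLaw
  have := hL.1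
  have hS := h.real_Ici_of_le hw.le hwT
  rw [max_eq_left hrw] at hS
  refine ⟨hL, fun h0 => ?_, ?_, hS⟩
  · rw [lintegral_eq_zero_iff (by fun_prop)] at h0
    have h1 : plateauLaw d r T (D T) (Ici w) = 0 := by
      refine measure_mono_null (fun v hv => ?_) h0
      simp only [Pi.zero_apply, mem_compl_iff, mem_ofPred_eq, ENNReal.ofReal_eq_zero, not_le]
      exact hw.trans_le hv
    have h2 := h.tail_pos ⟨hrw, hwT⟩
    rw [← hS, Measure.real, h1] at h2
    exact lt_irrefl _ h2
  · refine ne_top_of_le_ne_top ENNReal.ofReal_ne_top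
      (b := ENNReal.ofReal T) ?_
    calc _ ≤ ∫⁻ _, ENNReal.ofReal T ∂(plateauLaw d r T (D T)) := by
          refine lintegral_mono_ae ?_
          have : ∀ᵐ v ∂(plateauLaw d r T (D T)), v ∉ Ioi T :=
            measure_eq_zero_iff_ae_notMem.1 (plateauLaw_Ioi d r T _)
          filter_upwards [this] with v hv
          exact ENNReal.ofReal_le_ofReal (not_lt.1 hv)
      _ = _ := by simp

theorem isRegular (h : IsTail D d r T) {κ : ℝ}
    (hκ : ∀ v ∈ Ico r T, 0 < d v ∧ v - D v / d v = κ) : IsRegular (plateauLaw d r T (D T)) := by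
  refine ⟨_, h.isDensityBelowMax, ?_⟩
  rw [h.belowMax_eq]
  intro u hu v hv huv
  have hval : ∀ t ∈ Ico r T, (t : EReal) -
      ((saleProb (plateauLaw d r T (D T)) t / (plateauDensity d r t : ℝ≥0∞) : ℝ≥0∞) : EReal)
        = (κ : EReal) := by
    intro t ht
    have h0 := hκ t ht
    rw [h.saleProb_of_le (h.nonneg.trans ht.1) ht.2.le, max_eq_left ht.1, plateauDensity,
      indicator_of_mem (show t ∈ Ici r from ht.1),
      show (((d t).toNNReal : ℝ≥0) : ℝ≥0∞) = ENNReal.ofReal (d t) from rfl,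
      ← ENNReal.ofReal_div_of_pos h0.1, EReal.coe_ennreal_ofReal,
      max_eq_left (div_nonneg (h.tail_pos ⟨ht.1, ht.2.le⟩).le h0.1.le), ← EReal.coe_sub, h0.2]
  -- On the plateau the density is zero and the virtual value is `⊥`, so monotonicity can only fail
  -- beyond `r`, where the virtual value is constant.
  rcases lt_or_ge u r with hur | hur
  · have h1 : plateauDensity d r u = 0 := indicator_of_notMem (not_le.2 hur) _
    have h2 : saleProb (plateauLaw d r T (D T)) u ≠ 0 := by
      rw [h.saleProb_of_le hu.1 hu.2.le, max_eq_right hur.le, h.left]; simp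
    simp only [h1, ENNReal.coe_zero, ENNReal.div_zero h2, EReal.coe_ennreal_top, EReal.sub_top]
    exact bot_le
  · simp only [hval u ⟨hur, hu.2⟩, hval v ⟨hur.trans huv, hv.2⟩, le_refl]

theorem isMHR (h : IsTail D d r T) {κ : ℝ} (hκ : ∀ v ∈ Ico r T, d v / D v = κ) :
    IsMHR (plateauLaw d r T (D T)) := by
  refine ⟨_, h.isDensityBelowMax, ?_⟩
  rw [h.belowMax_eq]
  intro u hu v hv huv
  have hval : ∀ t ∈ Ico r T, (plateauDensity d r t : ℝ≥0∞) /
      saleProb (plateauLaw d r T (D T)) t = ENNReal.ofReal κ := by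
    intro t ht
    rw [h.saleProb_of_le (h.nonneg.trans ht.1) ht.2.le, max_eq_left ht.1, plateauDensity,
      indicator_of_mem (show t ∈ Ici r from ht.1),
      show (((d t).toNNReal : ℝ≥0) : ℝ≥0∞) = ENNReal.ofReal (d t) from rfl,
      ← ENNReal.ofReal_div_of_pos (h.tail_pos ⟨ht.1, ht.2.le⟩), hκ t ht]
  rcases lt_or_ge u r with hur | hur
  · have h1 : plateauDensity d r u = 0 := indicator_of_notMem (not_le.2 hur) _
    simp only [h1, ENNReal.coe_zero, ENNReal.zero_div]
    exact bot_le
  · simp only [hval u ⟨hur, hu.2⟩, hval v ⟨hur.trans huv, hv.2⟩, le_refl]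

end IsTail

end Pricing

/-! ### Upper bounds on the guarantee from the extremal laws -/

namespace Pricing

section Regular

variable {w q ρ τ : ℝ}

/-- The tail `A / (A + B * (v - r))` has constant virtual value. -/
theorem isTail_div {A B r T : ℝ} (hA : 0 < A) (hB : 0 < B) (hr : 0 ≤ r) (hrT : r < T) :
    IsTail (fun v => A / (A + B * (v - r))) (fun v => A * B / (A + B * (v - r)) ^ 2) r T := by
  have hpos : ∀ v ∈ Icc r T, 0 < A + B * (v - r) := fun v hv => by
    have : 0 ≤ B * (v - r) := mul_nonneg hB.le (sub_nonneg.2 hv.1)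
    linarith
  refine ⟨hr, hrT, by simp [hA.ne'], div_pos hA (hpos T ⟨hrT.le, le_rfl⟩), fun v hv => ?_,
    fun v hv => by have := hpos v hv; positivity, by fun_prop, ?_⟩
  · have h1 : HasDerivAt (fun v => A + B * (v - r)) B v := by
      simpa using (((hasDerivAt_id v).sub_const r).const_mul B).const_add A
    have h2 := (hasDerivAt_const v A).fun_div h1 (hpos v hv).ne'
    rwa [zero_mul, zero_sub, neg_div] at h2
  · exact ContinuousOn.div (by fun_prop) (by fun_prop) fun v hv => (pow_pos (hpos v hv) 2).ne'

/-- The extremal family: the plateau ends at `w * ρ`, `1 / S` is linear from there on with value `1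
/ q` at `w`, and the remaining mass sits at `w * τ`. -/
theorem exists_mem_regularClass (hw : 0 < w) (hq : 0 < q) (hq1 : q < 1) (hρ : 0 ≤ ρ)
    (hρ1 : ρ < 1) (hτ : 1 ≤ τ) : ∃ F ∈ regularClass w {q}, IsLaw F ∧
      (∀ t, 0 ≤ t → t ≤ ρ → F.real (Ici (w * t)) = 1) ∧
      (∀ t, ρ ≤ t → t ≤ τ →
        F.real (Ici (w * t)) = q * (1 - ρ) / (q * (1 - ρ) + (1 - q) * (t - ρ))) ∧
      ∀ t, τ < t → F.real (Ici (w * t)) = 0 := by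
  have hA : 0 < q * (w * (1 - ρ)) := by
    have : 0 < 1 - ρ := by linarith
    positivity
  have hB : 0 < 1 - q := by linarith
  have h := isTail_div hA hB (mul_nonneg hw.le hρ) (by nlinarith : w * ρ < w * τ)
  have hmem := h.mem_consistentLaws (w := w) (by nlinarith) hw (by nlinarith)
  have hval : ∀ t, ρ ≤ t → q * (w * (1 - ρ)) / (q * (w * (1 - ρ)) + (1 - q) * (w * t - w * ρ))
      = q * (1 - ρ) / (q * (1 - ρ) + (1 - q) * (t - ρ)) := by
    intro t ht
    have h1 : 0 < q * (1 - ρ) := mul_pos hq (by linarith)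
    have h2 : 0 ≤ (1 - q) * (t - ρ) := mul_nonneg hB.le (by linarith)
    rw [← mul_div_mul_left (q * (1 - ρ)) _ hw.ne']
    congr 1 <;> ring
  have hwq : (q * (w * (1 - ρ)) / (q * (w * (1 - ρ)) + (1 - q) * (w - w * ρ))) = q := by
    have := hval 1 hρ1.le
    rw [mul_one] at this
    rw [this]
    have : 0 < 1 - ρ := by linarith
    field_simp
    ring
  refine ⟨_, ⟨by simpa only [hwq] using hmem,
    h.isRegular (κ := w * ρ - q * (w * (1 - ρ)) / (1 - q)) fun v hv => ?_⟩, h.isLaw,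
    fun t ht ht' => ?_, fun t ht ht' => ?_, fun t ht => ?_⟩
  · have hD : 0 < q * (w * (1 - ρ)) + (1 - q) * (v - w * ρ) := by
      have : 0 ≤ (1 - q) * (v - w * ρ) := mul_nonneg hB.le (sub_nonneg.2 hv.1)
      linarith
    refine ⟨by positivity, ?_⟩
    rw [div_div_div_eq]
    generalize q * (w * (1 - ρ)) = A at hA hD ⊢
    field_simp
    ring
  · rw [h.real_Ici_of_le (by positivity) (by nlinarith), max_eq_right (by nlinarith), sub_self,
      mul_zero, add_zero, div_self hA.ne']
  · rw [h.real_Ici_of_le (mul_nonneg hw.le (hρ.trans ht)) (by nlinarith),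
      max_eq_left (by nlinarith), hval t ht]
  · exact IsTail.real_Ici_of_lt _ _ _ _ (by nlinarith)

theorem guarantee_regularClass_lt_of_lt (hw : 0 < w) (hq : 0 < q) (hq1 : q < 1) {t G : ℝ}
    (ht : 0 ≤ t) (htG : t < G) (hG : G ≤ 1) :
    guarantee (Measure.dirac (w * t)) (regularClass w {q}) < ENNReal.ofReal G := by
  have hG0 : 0 < G := ht.trans_lt htG
  have h1 : t / G < 1 := (div_lt_one hG0).2 htG
  have h0 : 0 ≤ t / G := by positivity
  have htt : t ≤ t / G := le_div_self ht hG0 hG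
  set ρ := (t / G + 1) / 2 with hρ
  have hρ0 : 0 < ρ := by linarith
  obtain ⟨F, hF, hL, hflat, -, -⟩ := exists_mem_regularClass hw hq hq1 hρ0.le
    (by linarith : ρ < 1) le_rfl
  have hx := hflat ρ hρ0.le le_rfl
  refine (guarantee_dirac_le hL hF (mul_nonneg hw.le ht) (mul_pos hw hρ0)
    (by rw [hx]; exact one_pos)).trans_lt ?_
  rw [hx, hflat t ht (by linarith), ENNReal.ofReal_lt_ofReal_iff hG0, mul_one, mul_one,
    mul_div_mul_left _ _ hw.ne', div_lt_iff₀ hρ0]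
  have : G * ρ = (t + G) / 2 := by rw [hρ]; field_simp
  linarith

theorem guarantee_regularClass_le_of_plateau (hw : 0 < w) (hq : 0 < q) (hq1 : q < 1)
    (hρ : 0 < ρ) (hρ1 : ρ < 1) {t : ℝ} (ht : ρ ≤ t) (ht1 : t ≤ 1) :
    guarantee (Measure.dirac (w * t)) (regularClass w {q}) ≤
      ENNReal.ofReal (t * (q * (1 - ρ)) / (ρ * (q * (1 - ρ) + (1 - q) * (t - ρ)))) := by
  obtain ⟨F, hF, hL, hflat, htail, -⟩ := exists_mem_regularClass hw hq hq1 hρ.le hρ1 le_rfl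
  have hx := hflat ρ hρ.le le_rfl
  refine (guarantee_dirac_le hL hF (mul_nonneg hw.le (hρ.le.trans ht)) (mul_pos hw hρ)
    (by rw [hx]; exact one_pos)).trans_eq ?_
  rw [hx, htail t ht ht1, mul_one, mul_assoc, mul_div_mul_left _ _ hw.ne', ← mul_div_assoc,
    div_div, mul_comm ρ]

/-- The full tail `q / (q + (1 - q) * t)` has infinite mean and is not in the class. It is
approached by truncations at `w * (n + 1)`, with that maximum as benchmark price. -/
theorem guarantee_regularClass_le_of_untruncated (hw : 0 < w) (hq : 0 < q) (hq1 : q < 1) {t : ℝ}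
    (ht : 0 ≤ t) (ht1 : t ≤ 1) :
    guarantee (Measure.dirac (w * t)) (regularClass w {q}) ≤
      ENNReal.ofReal ((1 - q) * t / (q + (1 - q) * t)) := by
  have hB : 0 < 1 - q := by linarith
  have hden : 0 < q + (1 - q) * t := by positivity
  have hn : ∀ n : ℕ, guarantee (Measure.dirac (w * t)) (regularClass w {q}) ≤
      ENNReal.ofReal ((1 - q) * t / (q + (1 - q) * t)
        + q * t / (q + (1 - q) * t) * (1 / ((n : ℝ) + 1))) := by
    intro n
    have hτ0 : (0 : ℝ) < (n : ℝ) + 1 := by positivity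
    have hτ : (1 : ℝ) ≤ (n : ℝ) + 1 := by simp
    obtain ⟨F, hF, hL, -, htail, -⟩ := exists_mem_regularClass hw hq hq1 le_rfl one_pos hτ
    have hx := htail _ hτ0.le le_rfl
    have hp := htail t ht (ht1.trans hτ)
    simp only [sub_zero, mul_one] at hx hp
    refine (guarantee_dirac_le hL hF (mul_nonneg hw.le ht) (mul_pos hw hτ0)
      (by rw [hx]; positivity)).trans_eq ?_
    rw [hx, hp]
    congr 1
    field_simp
    ring
  refine ge_of_tendsto' (x := Filter.atTop) (ENNReal.tendsto_ofReal ?_) hn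
  simpa using ((tendsto_one_div_add_atTop_nhds_zero_nat (𝕜 := ℝ)).const_mul
    (q * t / (q + (1 - q) * t))).const_add ((1 - q) * t / (q + (1 - q) * t))

theorem guarantee_regularClass_eq_zero (hw : 0 < w) (hq : 0 < q) (hq1 : q < 1) {t : ℝ}
    (ht : 1 < t) : guarantee (Measure.dirac (w * t)) (regularClass w {q}) = 0 := by
  obtain ⟨F, hF, hL, -, htail, hz⟩ := exists_mem_regularClass hw hq hq1 le_rfl one_pos le_rfl
  have hx := htail 1 zero_le_one le_rfl
  refine le_antisymm ((guarantee_dirac_le hL hF (mul_nonneg hw.le (by linarith))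
    (mul_pos hw one_pos) (by rw [hx]; simp [hq])).trans ?_) bot_le
  rw [hz t ht]
  simp

end Regular

section MHR

variable {w l ρ τ : ℝ}

/-- The tail `exp (-(k * (v - r)))` has constant hazard rate `k`. -/
theorem isTail_exp {k r T : ℝ} (hk : 0 < k) (hr : 0 ≤ r) (hrT : r < T) :
    IsTail (fun v => Real.exp (-(k * (v - r)))) (fun v => k * Real.exp (-(k * (v - r)))) r T := by
  refine ⟨hr, hrT, by simp, Real.exp_pos _, fun v _ => ?_, fun v _ => by positivity,
    by fun_prop, by fun_prop⟩
  have h1 : HasDerivAt (fun v => -(k * (v - r))) (-k) v := by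
    simpa using (((hasDerivAt_id v).sub_const r).const_mul k).fun_neg
  convert h1.exp using 1
  ring

theorem exists_mem_mhrClass (hw : 0 < w) (hl : 0 < l) (hρ : 0 ≤ ρ)
    (hρ1 : ρ < 1) (hτ : 1 ≤ τ) : ∃ F ∈ mhrClass w {Real.exp (-l)}, IsLaw F ∧
      (∀ t, 0 ≤ t → t ≤ ρ → F.real (Ici (w * t)) = 1) ∧
      (∀ t, ρ ≤ t → t ≤ τ →
        F.real (Ici (w * t)) = Real.exp (-(l * (t - ρ) / (1 - ρ)))) ∧
      ∀ t, τ < t → F.real (Ici (w * t)) = 0 := by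
  have hρ' : 0 < 1 - ρ := by linarith
  have hk : 0 < l / (w * (1 - ρ)) := by positivity
  have h := isTail_exp hk (mul_nonneg hw.le hρ) (by nlinarith : w * ρ < w * τ)
  have hmem := h.mem_consistentLaws (w := w) (by nlinarith) hw (by nlinarith)
  have hval : ∀ t, -(l / (w * (1 - ρ)) * (w * t - w * ρ)) = -(l * (t - ρ) / (1 - ρ)) := by
    intro t
    field_simp
  have hwq : -(l / (w * (1 - ρ)) * (w - w * ρ)) = -l := by
    field_simp
  refine ⟨_, ⟨by simpa only [hwq] using hmem,
    h.isMHR (κ := l / (w * (1 - ρ))) fun v hv => ?_⟩, h.isLaw,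
    fun t ht ht' => ?_, fun t ht ht' => ?_, fun t ht => ?_⟩
  · exact mul_div_cancel_right₀ _ (Real.exp_pos _).ne'
  · rw [h.real_Ici_of_le (by positivity) (by nlinarith), max_eq_right (by nlinarith), sub_self,
      mul_zero, neg_zero, Real.exp_zero]
  · rw [h.real_Ici_of_le (mul_nonneg hw.le (hρ.trans ht)) (by nlinarith),
      max_eq_left (by nlinarith), hval t]
  · exact IsTail.real_Ici_of_lt _ _ _ _ (by nlinarith)

theorem guarantee_mhrClass_lt_of_lt (hw : 0 < w) (hl : 0 < l) {t G : ℝ}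
    (ht : 0 ≤ t) (htG : t < G) (hG : G ≤ 1) :
    guarantee (Measure.dirac (w * t)) (mhrClass w {Real.exp (-l)}) < ENNReal.ofReal G := by
  have hG0 : 0 < G := ht.trans_lt htG
  have h1 : t / G < 1 := (div_lt_one hG0).2 htG
  have h0 : 0 ≤ t / G := by positivity
  have htt : t ≤ t / G := le_div_self ht hG0 hG
  set ρ := (t / G + 1) / 2 with hρ
  have hρ0 : 0 < ρ := by linarith
  obtain ⟨F, hF, hL, hflat, -, -⟩ := exists_mem_mhrClass hw hl hρ0.le
    (by linarith : ρ < 1) le_rfl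
  have hx := hflat ρ hρ0.le le_rfl
  refine (guarantee_dirac_le hL hF (mul_nonneg hw.le ht) (mul_pos hw hρ0)
    (by rw [hx]; exact one_pos)).trans_lt ?_
  rw [hx, hflat t ht (by linarith), ENNReal.ofReal_lt_ofReal_iff hG0, mul_one, mul_one,
    mul_div_mul_left _ _ hw.ne', div_lt_iff₀ hρ0]
  have : G * ρ = (t + G) / 2 := by rw [hρ]; field_simp
  linarith

theorem guarantee_mhrClass_le_of_plateau (hw : 0 < w) (hl : 0 < l)
    (hρ : 0 < ρ) (hρ1 : ρ < 1) {t : ℝ} (ht : ρ ≤ t) (ht1 : t ≤ 1) :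
    guarantee (Measure.dirac (w * t)) (mhrClass w {Real.exp (-l)}) ≤
      ENNReal.ofReal (t / ρ * Real.exp (-(l * (t - ρ) / (1 - ρ)))) := by
  obtain ⟨F, hF, hL, hflat, htail, -⟩ := exists_mem_mhrClass hw hl hρ.le hρ1 le_rfl
  have hx := hflat ρ hρ.le le_rfl
  refine (guarantee_dirac_le hL hF (mul_nonneg hw.le (hρ.le.trans ht)) (mul_pos hw hρ)
    (by rw [hx]; exact one_pos)).trans_eq ?_
  rw [hx, htail t ht ht1, mul_one, mul_assoc, mul_div_mul_left _ _ hw.ne', div_mul_eq_mul_div]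

/-- The exponential revenue peaks at `w / l`, so truncation there loses nothing; `l ≤ 1` ensures
that this lies at or beyond `w`. -/
theorem guarantee_mhrClass_le_of_exponential (hw : 0 < w) (hl : 0 < l) (hl1 : l ≤ 1) {t : ℝ}
    (ht : 0 ≤ t) (ht1 : t ≤ 1) :
    guarantee (Measure.dirac (w * t)) (mhrClass w {Real.exp (-l)}) ≤
      ENNReal.ofReal (l * t * Real.exp (1 - l * t)) := by
  have hτ : 1 ≤ 1 / l := (one_le_div hl).2 hl1
  obtain ⟨F, hF, hL, -, htail, -⟩ := exists_mem_mhrClass hw hl le_rfl one_pos hτ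
  have hx := htail (1 / l) (by positivity) le_rfl
  have hp := htail t ht (ht1.trans hτ)
  rw [sub_zero, sub_zero, div_one, mul_one_div_cancel hl.ne'] at hx
  rw [sub_zero, sub_zero, div_one] at hp
  refine (guarantee_dirac_le hL hF (mul_nonneg hw.le ht) (mul_pos hw (by positivity : 0 < 1 / l))
    (by rw [hx]; exact Real.exp_pos _)).trans_eq ?_
  rw [hx, hp, sub_eq_add_neg 1, Real.exp_add, Real.exp_neg 1]
  congr 1
  field_simp

theorem guarantee_mhrClass_eq_zero (hw : 0 < w) (hl : 0 < l) {t : ℝ}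
    (ht : 1 < t) : guarantee (Measure.dirac (w * t)) (mhrClass w {Real.exp (-l)}) = 0 := by
  obtain ⟨F, hF, hL, -, htail, hz⟩ := exists_mem_mhrClass hw hl le_rfl one_pos le_rfl
  have hx := htail 1 zero_le_one le_rfl
  refine le_antisymm ((guarantee_dirac_le hL hF (mul_nonneg hw.le (by linarith))
    (mul_pos hw one_pos) (by rw [hx]; exact Real.exp_pos _)).trans ?_) bot_le
  rw [hz t ht]
  simp

end MHR

end Pricing

/-! ### The three regular regimes -/

namespace Pricing

variable {w q : ℝ}

/-- Here `t` equals the minimal plateau ratio at `t`, attained at `√q`. Smaller prices lose to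
plateaus close to `w`, larger ones to the plateau at `√q`. -/
theorem regularClass_optimal_of_le_quarter (hw : 0 < w) (hq : 0 < q) (h4 : q ≤ 1 / 4) :
    (∀ p : ℝ, IsOptimalPrice (regularClass w {q}) p ↔ p = w * (2 * √q) / (1 + √q)) ∧
      maximinRatio deterministicMechanisms (regularClass w {q}) =
        ENNReal.ofReal (2 * √q / (1 + √q)) := by
  have hq1 : q < 1 := by linarith
  obtain ⟨s, hs, rfl⟩ : ∃ s, 0 < s ∧ q = s ^ 2 :=
    ⟨√q, Real.sqrt_pos.2 hq, (Real.sq_sqrt hq.le).symm⟩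
  rw [Real.sqrt_sq hs.le, mul_div_assoc]
  have hs2 : s ≤ 1 / 2 := by nlinarith
  have ht0 : 0 < 2 * s / (1 + s) := by positivity
  have ht : 2 * s / (1 + s) * (1 + s) = 2 * s := div_mul_cancel₀ _ (by positivity)
  set t := 2 * s / (1 + s) with htdef
  have hst : s ≤ t := by
    rw [htdef, le_div_iff₀ (by linarith)]; nlinarith
  have ht1 : t ≤ 1 := by
    rw [htdef, div_le_one (by linarith)]; linarith
  have hkey : (1 - s ^ 2) * t = 2 * s * (1 - s) := by linear_combination (1 - s) * ht
  refine isOptimalPrice_iff_and_maximinRatio (by positivity)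
    (fun F hF => le_ratio_of_mem_regularClass hw hq ht0 ht1 ht0.le le_rfl ?_ ?_ hF) ?_ ?_
  · have : s ^ 2 + (1 - s ^ 2) * t ≤ 1 - s ^ 2 := by rw [hkey]; nlinarith
    nlinarith
  · intro r hr hrt
    have h1 : (1 - t) * s ^ 2 + (t - r) = 2 * s - s ^ 2 - r := by linear_combination hkey
    -- The difference of the two sides is exactly `(r - s) ^ 2`: this is why the plateau at `√q` is
    -- the worst.
    have h2 : r * (2 * s - s ^ 2 - r) ≤ s ^ 2 * (1 - r) := by nlinarith [sq_nonneg (r - s)]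
    rw [h1]
    nlinarith
  · refine (guarantee_regularClass_le_of_plateau hw hq hq1 hs (by linarith) hst ht1).trans
      (ENNReal.ofReal_le_ofReal ?_)
    have h1 : s ^ 2 * (1 - s) + (1 - s ^ 2) * (t - s) = s * (1 - s) := by
      linear_combination hkey
    have : 0 < 1 - s := by linarith
    rw [h1, div_le_iff₀ (by positivity)]
    exact le_of_eq (by ring)
  · intro p hp hne
    obtain ⟨t', rfl⟩ : ∃ t', p = w * t' := ⟨p / w, by field_simp⟩
    have ht' : 0 ≤ t' := nonneg_of_mul_nonneg_right hp hw
    rcases lt_or_gt_of_ne (fun h : t' = t => hne (by rw [h])) with hlt | hlt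
    · exact guarantee_regularClass_lt_of_lt hw hq hq1 ht' hlt ht1
    rcases lt_or_ge 1 t' with h1 | h1
    · rw [guarantee_regularClass_eq_zero hw hq hq1 h1]
      exact ENNReal.ofReal_pos.2 ht0
    refine (guarantee_regularClass_le_of_plateau hw hq hq1 hs (by linarith)
      (hst.trans hlt.le) h1).trans_lt ((ENNReal.ofReal_lt_ofReal_iff ht0).2 ?_)
    have hs1 : 0 < 1 - s := by linarith
    have h2 : 0 < (1 - s ^ 2) * (t' - s) := mul_pos (by linarith) (by linarith)
    rw [div_lt_iff₀ (by positivity)]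
    have h3 : 0 < s * (1 - s) * (t' - t) := mul_pos (mul_pos hs hs1) (by linarith)
    have e : t * (s * (s ^ 2 * (1 - s) + (1 - s ^ 2) * (t' - s))) - t' * (s ^ 2 * (1 - s))
        = s * (s * (1 - s) * (t' - t)) := by
      linear_combination s * (t' - s) * hkey + s * s * (1 - s) * ht
    have := mul_pos hs h3
    linarith

/-- Here the worst plateau, at `2 * q`, and the untruncated tail give the same ratio at `t`. The
former excludes larger prices and the latter smaller ones. At `q = 1 / 2` the plateau would reach
`w`, hence the strict inequality. -/
theorem regularClass_optimal_of_lt_half (hw : 0 < w) (h4 : 1 / 4 ≤ q) (h2 : q < 1 / 2) :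
    (∀ p : ℝ, IsOptimalPrice (regularClass w {q}) p ↔ p = w * q * (3 - 4 * q) / (1 - q)) ∧
      maximinRatio deterministicMechanisms (regularClass w {q}) =
        ENNReal.ofReal ((3 - 4 * q) / (4 * (1 - q))) := by
  have hq : 0 < q := by linarith
  have hq1 : q < 1 := by linarith
  have h1q : 0 < 1 - q := by linarith
  have ht0 : 0 < q * (3 - 4 * q) / (1 - q) := div_pos (mul_pos hq (by linarith)) h1q
  have hkey : (1 - q) * (q * (3 - 4 * q) / (1 - q)) = q * (3 - 4 * q) :=
    mul_div_cancel₀ _ h1q.ne'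
  rw [show w * q * (3 - 4 * q) / (1 - q) = w * (q * (3 - 4 * q) / (1 - q)) by ring]
  have hG0 : 0 < (3 - 4 * q) / (4 * (1 - q)) := div_pos (by linarith) (by linarith)
  have htG : q * (3 - 4 * q) / (1 - q) = 4 * q * ((3 - 4 * q) / (4 * (1 - q))) := by
    field_simp
  set t := q * (3 - 4 * q) / (1 - q) with htdef
  set G := (3 - 4 * q) / (4 * (1 - q)) with hGdef
  have hst : 2 * q ≤ t := by
    rw [htdef, le_div_iff₀ h1q]; nlinarith
  have ht1 : t ≤ 1 := by
    rw [htdef, div_le_one h1q]; nlinarith [sq_nonneg (1 - 2 * q)]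
  refine isOptimalPrice_iff_and_maximinRatio (by positivity)
    (fun F hF => le_ratio_of_mem_regularClass hw hq ht0 ht1 hG0.le (by nlinarith) ?_ ?_ hF) ?_ ?_
  · rw [htG] at hkey ⊢
    have hG : (1 - q) * (4 * G) = 3 - 4 * q := by
      apply mul_left_cancel₀ hq.ne'; linarith
    refine le_of_eq ?_
    linear_combination q * G * hG
  · intro r hr hrt
    have h1 : (1 - t) * q + (t - r) = 4 * q - 4 * q ^ 2 - r := by linear_combination hkey
    have h2 : r * (4 * q - 4 * q ^ 2 - r) ≤ 4 * q ^ 2 * (1 - r) := by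
      nlinarith [sq_nonneg (r - 2 * q)]
    rw [h1, htG]
    have := mul_le_mul_of_nonneg_left h2 hG0.le
    linarith
  · refine (guarantee_regularClass_le_of_plateau hw hq hq1 (by linarith : 0 < 2 * q)
      (by linarith) hst ht1).trans (ENNReal.ofReal_le_ofReal ?_)
    have h1 : q * (1 - 2 * q) + (1 - q) * (t - 2 * q) = 2 * q * (1 - 2 * q) := by
      linear_combination hkey
    have : 0 < 1 - 2 * q := by linarith
    rw [h1, div_le_iff₀ (by positivity), htG]
    exact le_of_eq (by ring)
  · intro p hp hne
    obtain ⟨t', rfl⟩ : ∃ t', p = w * t' := ⟨p / w, by field_simp⟩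
    have ht' : 0 ≤ t' := nonneg_of_mul_nonneg_right hp hw
    rcases lt_or_gt_of_ne (fun h : t' = t => hne (by rw [h])) with hlt | hlt
    · refine (guarantee_regularClass_le_of_untruncated hw hq hq1 ht'
        (hlt.le.trans ht1)).trans_lt ((ENNReal.ofReal_lt_ofReal_iff hG0).2 ?_)
      rw [div_lt_iff₀ (by positivity)]
      have hG : (1 - q) * (4 * G) = 3 - 4 * q := by
        apply mul_left_cancel₀ hq.ne'; rw [htG] at hkey; linarith
      have hG1 : G < 1 := by
        rw [hGdef, div_lt_one (by linarith)]; linarith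
      have h5 : G * (q + (1 - q) * t') - (1 - q) * t' = (1 - q) * (1 - G) * (t - t') := by
        linear_combination (G - 1) * hkey + q * hG
      have h6 : 0 < (1 - q) * (1 - G) * (t - t') :=
        mul_pos (mul_pos h1q (by linarith)) (by linarith)
      linarith
    rcases lt_or_ge 1 t' with h1 | h1
    · rw [guarantee_regularClass_eq_zero hw hq hq1 h1]
      exact ENNReal.ofReal_pos.2 hG0
    refine (guarantee_regularClass_le_of_plateau hw hq hq1 (by linarith : 0 < 2 * q)
      (by linarith) (hst.trans hlt.le) h1).trans_lt ((ENNReal.ofReal_lt_ofReal_iff hG0).2 ?_)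
    have hs1 : 0 < 1 - 2 * q := by linarith
    have h2 : 0 ≤ (1 - q) * (t' - 2 * q) := mul_nonneg h1q.le (by linarith)
    rw [div_lt_iff₀ (by positivity)]
    have hGq : 0 < (4 * G * (1 - q)) * 2 - 4 * (1 - 2 * q) := by
      have : 4 * G * (1 - q) = 3 - 4 * q := by rw [hGdef]; field_simp
      rw [this]; linarith
    have h3 : 0 < q * ((4 * G * (1 - q)) * 2 - 4 * (1 - 2 * q)) * (t' - t) :=
      mul_pos (mul_pos hq hGq) (by linarith)
    have e : 4 * (G * (2 * q * (q * (1 - 2 * q) + (1 - q) * (t' - 2 * q)))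
          - t' * (q * (1 - 2 * q)))
        = q * ((4 * G * (1 - q)) * 2 - 4 * (1 - 2 * q)) * (t' - t) := by
      linear_combination 8 * q * G * hkey - 4 * q * (1 - 2 * q) * htG
    linarith

theorem regularClass_optimal_of_half_le (hw : 0 < w) (h2 : 1 / 2 ≤ q) (hq1 : q < 1) :
    (∀ p : ℝ, IsOptimalPrice (regularClass w {q}) p ↔ p = w) ∧
      maximinRatio deterministicMechanisms (regularClass w {q}) = ENNReal.ofReal (1 - q) := by
  have hq : 0 < q := by linarith
  have h1q : 0 < 1 - q := by linarith
  have h := isOptimalPrice_iff_and_maximinRatio (𝓕 := regularClass w {q}) (p₀ := w * 1)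
    (G := 1 - q) (by positivity)
    (fun F hF => le_ratio_of_mem_regularClass hw hq one_pos le_rfl h1q.le (by linarith)
      (by linarith) ?_ hF) ?_ ?_
  · simpa using h
  · intro s hs hs1
    have := mul_nonneg hs (by linarith : 0 ≤ 1 - s)
    nlinarith
  · exact (guarantee_regularClass_le_of_untruncated hw hq hq1 zero_le_one le_rfl).trans
      (ENNReal.ofReal_le_ofReal (by simp))
  · intro p hp hne
    obtain ⟨t', rfl⟩ : ∃ t', p = w * t' := ⟨p / w, by field_simp⟩
    have ht' : 0 ≤ t' := nonneg_of_mul_nonneg_right hp hw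
    rcases lt_or_gt_of_ne (fun h : t' = 1 => hne (by rw [h])) with hlt | hlt
    · refine (guarantee_regularClass_le_of_untruncated hw hq hq1 ht'
        hlt.le).trans_lt ((ENNReal.ofReal_lt_ofReal_iff h1q).2 ?_)
      rw [div_lt_iff₀ (by positivity)]
      nlinarith [mul_pos (mul_pos hq h1q) (sub_pos.2 hlt)]
    · rw [guarantee_regularClass_eq_zero hw hq hq1 hlt]
      exact ENNReal.ofReal_pos.2 h1q

end Pricing

/-! ### The three mhr regimes, in terms of `l = log (1 / q)` -/

namespace Pricing

variable {w l : ℝ}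

/-- For `l * (1 - t) = (1 - r) ^ 2 / r`, the plateau at `r` minimizes the ratio at `t` over all
plateaus. -/
theorem plateau_ratio_min {r t s : ℝ} (hr : 0 < r) (hr1 : r < 1) (ht : 0 < t)
    (hrt : l * (1 - t) = (1 - r) ^ 2 / r) (hs1 : s < 1) :
    t / r * Real.exp (-(l * (t - r) / (1 - r))) * s ≤
      t * Real.exp (-(l * (t - s) / (1 - s))) := by
  have h1r : 0 < 1 - r := by linarith
  have h1s : 0 < 1 - s := by linarith
  have hexp : ∀ x, x < 1 → -(l * (t - x) / (1 - x)) = -l + (1 - r) ^ 2 / r / (1 - x) := by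
    intro x hx
    have : 0 < 1 - x := by linarith
    rw [← hrt]
    field_simp
    ring
  -- The relation between `r` and `t` is the first-order condition in the plateau position. Because
  -- of it, `x + 1 ≤ exp x` leaves a multiple of the square `(s - r) ^ 2`, so the stationary point
  -- is a global minimum.
  have h2 : s / r ≤ Real.exp ((1 - r) ^ 2 / r / (1 - s) - (1 - r) ^ 2 / r / (1 - r)) := by
    refine le_trans ?_ (Real.add_one_le_exp _)
    have e : (1 - r) ^ 2 / r / (1 - s) - (1 - r) ^ 2 / r / (1 - r) + 1 - s / r
        = (s - r) ^ 2 / (r * (1 - s)) := by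
      field_simp
      ring
    have : 0 ≤ (s - r) ^ 2 / (r * (1 - s)) := by positivity
    linarith
  rw [hexp r hr1, hexp s hs1]
  calc t / r * Real.exp (-l + (1 - r) ^ 2 / r / (1 - r)) * s
      = t * (s / r * Real.exp (-l + (1 - r) ^ 2 / r / (1 - r))) := by ring
    _ ≤ t * (Real.exp ((1 - r) ^ 2 / r / (1 - s) - (1 - r) ^ 2 / r / (1 - r)) *
          Real.exp (-l + (1 - r) ^ 2 / r / (1 - r))) := by gcongr
    _ = _ := by rw [← Real.exp_add]; ring_nf

/-- Common part of the two regimes in which the worst plateau binds. The condition `1 - r ≤ l * t`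
makes the ratio against the plateau at `r` strictly decreasing beyond `t`; prices below `t` are left
to `hlow`, since different laws exclude them. -/
theorem mhrClass_optimal_of_plateau (hw : 0 < w) (hl : 0 < l) {r t : ℝ} (hr : 0 < r) (hr1 : r < 1)
    (hrt : l * (1 - t) = (1 - r) ^ 2 / r) (hle : r ≤ t) (hlt : 1 - r ≤ l * t) {G : ℝ}
    (hG : G = t / r * Real.exp (-l + (1 / r - 1))) (hGt : G ≤ t)
    (hhigh : ∀ s, 1 ≤ s → G * s * Real.exp (-(l * s)) ≤ t * Real.exp (-(l * t)))
    (hlow : ∀ t', 0 ≤ t' → t' < t →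
      guarantee (Measure.dirac (w * t')) (mhrClass w {Real.exp (-l)}) < ENNReal.ofReal G) :
    (∀ p : ℝ, IsOptimalPrice (mhrClass w {Real.exp (-l)}) p ↔ p = w * t) ∧
      maximinRatio deterministicMechanisms (mhrClass w {Real.exp (-l)}) = ENNReal.ofReal G := by
  have ht : 0 < t := hr.trans_le hle
  have h1r : 0 < 1 - r := by linarith
  have ht1 : t ≤ 1 := by
    have : 0 ≤ l * (1 - t) := by rw [hrt]; positivity
    linarith [nonneg_of_mul_nonneg_right this hl]
  have hG0 : 0 < G := by rw [hG]; positivity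
  have hG' : G = t / r * Real.exp (-(l * (t - r) / (1 - r))) := by
    rw [hG]
    congr 2
    have : l * (t - r) = l * (1 - r) - (1 - r) ^ 2 / r := by rw [← hrt]; ring
    rw [this]
    field_simp
    ring
  refine isOptimalPrice_iff_and_maximinRatio (by positivity)
    (fun F hF => le_ratio_of_mem_mhrClass hw ht ht1 hG0.le hGt hhigh
      (fun s _ hst => ?_) hF) ?_ ?_
  · rw [hG']
    exact plateau_ratio_min hr hr1 ht hrt (hst.trans_le ht1)
  · exact (guarantee_mhrClass_le_of_plateau hw hl hr hr1 hle ht1).trans_eq (by rw [hG'])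
  · intro p hp hne
    obtain ⟨t', rfl⟩ : ∃ t', p = w * t' := ⟨p / w, by field_simp⟩
    have ht' : 0 ≤ t' := nonneg_of_mul_nonneg_right hp hw
    rcases lt_or_gt_of_ne (fun h : t' = t => hne (by rw [h])) with h1 | h1
    · exact hlow t' ht' h1
    rcases lt_or_ge 1 t' with h2 | h2
    · rw [guarantee_mhrClass_eq_zero hw hl h2]
      exact ENNReal.ofReal_pos.2 hG0
    refine (guarantee_mhrClass_le_of_plateau hw hl hr hr1
      (hle.trans h1.le) h2).trans_lt ((ENNReal.ofReal_lt_ofReal_iff hG0).2 ?_)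
    have h3 : t' / t < Real.exp (l * (t' - t) / (1 - r)) := by
      have hpos : 0 < l * (t' - t) / (1 - r) := by
        have : 0 < t' - t := by linarith
        positivity
      refine lt_of_le_of_lt ?_ (Real.add_one_lt_exp hpos.ne')
      have : (t' - t) / t ≤ l * (t' - t) / (1 - r) := by
        rw [div_le_div_iff₀ ht h1r]
        nlinarith
      rw [sub_div, div_self ht.ne'] at this
      linarith
    rw [hG']
    calc t' / r * Real.exp (-(l * (t' - r) / (1 - r)))
        = t / r * (t' / t * Real.exp (-(l * (t' - r) / (1 - r)))) := by field_simp
      _ < t / r * (Real.exp (l * (t' - t) / (1 - r)) *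
            Real.exp (-(l * (t' - r) / (1 - r)))) := by gcongr
      _ = _ := by rw [← Real.exp_add]; congr 2; ring

theorem mul_exp_one_sub_lt {x y : ℝ} (hx : 0 ≤ x) (hxy : x < y) (hy : y ≤ 1) :
    x * Real.exp (1 - x) < y * Real.exp (1 - y) := by
  have hy0 : 0 < y := hx.trans_lt hxy
  have h1 : x / y < Real.exp (x - y) := by
    refine lt_of_le_of_lt ?_ (Real.add_one_lt_exp (sub_neg.2 hxy).ne)
    rw [div_le_iff₀ hy0]
    nlinarith
  calc x * Real.exp (1 - x) = y * (x / y * Real.exp (1 - x)) := by field_simp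
    _ < y * (Real.exp (x - y) * Real.exp (1 - x)) := by gcongr
    _ = _ := by rw [← Real.exp_add]; congr 2; ring

theorem mul_mul_exp_neg_le (s : ℝ) : l * s * Real.exp (-(l * s)) ≤ Real.exp (-1) := by
  have h := Real.add_one_le_exp (l * s - 1)
  calc l * s * Real.exp (-(l * s)) ≤ Real.exp (l * s - 1) * Real.exp (-(l * s)) := by
        gcongr; linarith
    _ = _ := by rw [← Real.exp_add]; congr 1; ring

theorem mhrClass_optimal_of_le_exp_neg_one (hw : 0 < w) (hl : 0 < l) (hle : l ≤ Real.exp (-1)) :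
    (∀ p : ℝ, IsOptimalPrice (mhrClass w {Real.exp (-l)}) p ↔ p = w) ∧
      maximinRatio deterministicMechanisms (mhrClass w {Real.exp (-l)}) =
        ENNReal.ofReal (Real.exp 1 * Real.exp (-l) * l) := by
  have hG0 : 0 < Real.exp 1 * Real.exp (-l) * l := by positivity
  have hl1 : l < 1 := hle.trans_lt (Real.exp_lt_one_iff.2 (by norm_num))
  have hel : Real.exp 1 * l ≤ 1 := by
    calc Real.exp 1 * l ≤ Real.exp 1 * Real.exp (-1) := by gcongr
      _ = 1 := by rw [← Real.exp_add]; simp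
  have hGq : Real.exp 1 * Real.exp (-l) * l ≤ Real.exp (-l) := by
    nlinarith [Real.exp_pos (-l)]
  have hGe : Real.exp 1 * Real.exp (-l) * l = l * 1 * Real.exp (1 - l * 1) := by
    rw [mul_one, sub_eq_add_neg, Real.exp_add]; ring
  have h := isOptimalPrice_iff_and_maximinRatio (𝓕 := mhrClass w {Real.exp (-l)}) (p₀ := w * 1)
    (G := Real.exp 1 * Real.exp (-l) * l) (by positivity)
    (fun F hF => le_ratio_of_mem_mhrClass hw one_pos le_rfl hG0.le
      (hGq.trans (Real.exp_le_one_iff.2 (by linarith))) ?_ ?_ hF) ?_ ?_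
  · simpa using h
  · intro s hs
    have h1 := mul_mul_exp_neg_le (l := l) s
    rw [mul_one, one_mul]
    calc Real.exp 1 * Real.exp (-l) * l * s * Real.exp (-(l * s))
        = Real.exp 1 * Real.exp (-l) * (l * s * Real.exp (-(l * s))) := by ring
      _ ≤ Real.exp 1 * Real.exp (-l) * Real.exp (-1) := by gcongr
      _ = Real.exp (-l) := by rw [← Real.exp_add, ← Real.exp_add]; congr 1; ring
  · intro s hs hs1
    have : 0 < 1 - s := by linarith
    rw [mul_div_assoc, div_self this.ne', mul_one, one_mul]
    nlinarith [Real.exp_pos (-l)]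
  · exact (guarantee_mhrClass_le_of_exponential hw hl hl1.le zero_le_one le_rfl).trans_eq
      (by rw [hGe])
  · intro p hp hne
    obtain ⟨t', rfl⟩ : ∃ t', p = w * t' := ⟨p / w, by field_simp⟩
    have ht' : 0 ≤ t' := nonneg_of_mul_nonneg_right hp hw
    rcases lt_or_gt_of_ne (fun h : t' = 1 => hne (by rw [h])) with hlt | hlt
    · refine (guarantee_mhrClass_le_of_exponential hw hl hl1.le ht'
        hlt.le).trans_lt ((ENNReal.ofReal_lt_ofReal_iff hG0).2 ?_)
      rw [hGe]
      exact mul_exp_one_sub_lt (by positivity) (by gcongr) (by linarith)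
    · rw [guarantee_mhrClass_eq_zero hw hl hlt]
      exact ENNReal.ofReal_pos.2 hG0

/-- The regime of low conversion: `u` solves `log u + u = 1 + l`. -/
theorem mhrClass_optimal_of_low (hw : 0 < w) (hl : 0 < l) {u t : ℝ} (hu : 1 < u)
    (hul : Real.log u + u = 1 + l) (ht : l * (1 - t) = u + 1 / u - 2)
    (hlog : Real.log u - 1 / u ≤ Real.log l) :
    (∀ p : ℝ, IsOptimalPrice (mhrClass w {Real.exp (-l)}) p ↔ p = w * t) ∧
      maximinRatio deterministicMechanisms (mhrClass w {Real.exp (-l)}) = ENNReal.ofReal t := by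
  have hu0 : 0 < u := one_pos.trans hu
  have hlogu : 0 < Real.log u := Real.log_pos hu
  have hinv : 1 / u < 1 := (div_lt_one hu0).2 hu
  have huinv : 0 < 1 / u := by positivity
  have hlt : l * t = Real.log u + 1 - 1 / u := by linear_combination -hul - ht
  have hrt : l * (1 - t) = (1 - 1 / u) ^ 2 / (1 / u) := by
    rw [ht]; field_simp; ring
  have hle : 1 / u ≤ t := by
    have h1 : 1 - 1 / u ≤ l * (1 / u) := by
      rw [mul_one_div, le_div_iff₀ hu0, sub_mul, div_mul_cancel₀ _ hu0.ne']; linarith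
    have h2 : l * (1 - t) ≤ l * (1 - 1 / u) := by
      rw [hrt, div_le_iff₀ huinv]
      nlinarith
    linarith [le_of_mul_le_mul_left h2 hl]
  have ht0 : 0 < t := huinv.trans_le hle
  have ht1 : t ≤ 1 := by
    have : 0 ≤ l * (1 - t) := by rw [hrt]; positivity
    linarith [nonneg_of_mul_nonneg_right this hl]
  refine mhrClass_optimal_of_plateau hw hl huinv hinv hrt hle (by linarith) ?_ le_rfl ?_
    fun t' ht' htt => guarantee_mhrClass_lt_of_lt hw hl ht' htt ht1
  -- The equation for `u` says that the plateau ratio at `r = 1 / u` is `t` itself.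
  · have : -l + (1 / (1 / u) - 1) = -Real.log u := by rw [one_div_one_div]; linarith
    rw [this, Real.exp_neg, Real.exp_log hu0]
    field_simp
  · intro s _
    -- `hlog` is `l * t ≤ 1 + log l`: the ratio against the exponential tail is at least `t`, so
    -- that tail does not bind.
    have h1 : l * Real.exp (l * t) ≤ l * (Real.exp 1 * l) := by
      gcongr
      rw [← Real.exp_log hl, ← Real.exp_add, Real.exp_log hl, Real.exp_le_exp]
      linarith
    have h2 : l * (s * Real.exp (-(l * s))) ≤ l * Real.exp (-(l * t)) := by
      have h3 := mul_mul_exp_neg_le (l := l) s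
      have h4 : Real.exp (l * t) ≤ Real.exp 1 * l := le_of_mul_le_mul_left h1 hl
      have h5 : Real.exp (-1) ≤ l * Real.exp (-(l * t)) := by
        have := mul_le_mul_of_nonneg_right h4 (mul_nonneg (Real.exp_pos (-1)).le
          (Real.exp_pos (-(l * t))).le)
        have e1 : Real.exp (l * t) * (Real.exp (-1) * Real.exp (-(l * t))) = Real.exp (-1) := by
          rw [← Real.exp_add, ← Real.exp_add]; congr 1; ring
        have e2 : Real.exp 1 * l * (Real.exp (-1) * Real.exp (-(l * t)))
            = l * Real.exp (-(l * t)) := by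
          have : Real.exp 1 * Real.exp (-1) = 1 := by rw [← Real.exp_add]; simp
          linear_combination l * Real.exp (-(l * t)) * this
        rwa [e1, e2] at this
      linarith
    have h6 := le_of_mul_le_mul_left h2 hl
    have := mul_le_mul_of_nonneg_left h6 ht0.le
    linarith

/-- The intermediate regime: `x` solves `log x + x = -log l`. -/
theorem mhrClass_optimal_of_mid (hw : 0 < w) (hl : 0 < l) (hl1 : l < 1) {x t : ℝ} (hx : 0 < x)
    (hx1 : x < 1) (hxl : Real.log x + x = -Real.log l) (ht : l * (1 - t) = x + 1 / x - 2)
    (hlog : 1 / x - Real.log x ≤ 1 + l) :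
    (∀ p : ℝ, IsOptimalPrice (mhrClass w {Real.exp (-l)}) p ↔ p = w * t) ∧
      maximinRatio deterministicMechanisms (mhrClass w {Real.exp (-l)}) =
        ENNReal.ofReal (t / x * Real.exp (-l + (1 / x - 1))) := by
  have hlx : l * x = Real.exp (-x) := by
    rw [← Real.exp_log hl, ← Real.exp_log hx, ← Real.exp_add, Real.exp_log hx]
    congr 1; linarith
  have hlx1 : 1 - x ≤ l * x := by rw [hlx]; linarith [Real.add_one_le_exp (-x)]
  have hrt : l * (1 - t) = (1 - x) ^ 2 / x := by
    rw [ht]; field_simp; ring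
  have hle : x ≤ t := by
    have h2 : l * (1 - t) ≤ l * (1 - x) := by
      rw [hrt, div_le_iff₀ hx]
      nlinarith
    linarith [le_of_mul_le_mul_left h2 hl]
  have ht0 : 0 < t := hx.trans_le hle
  have ht1 : t ≤ 1 := by
    have : 0 ≤ l * (1 - t) := by rw [hrt]; positivity
    linarith [nonneg_of_mul_nonneg_right this hl]
  have hlt : 1 - x ≤ l * t := by
    have h1 : 1 / x - 1 ≤ l := by
      rw [← sub_nonneg]
      have : l - (1 / x - 1) = (l * x - (1 - x)) / x := by field_simp
      rw [this]
      exact div_nonneg (by linarith) hx.le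
    linarith
  -- The equation for `x` says that the worst plateau and the exponential tail give the same ratio
  -- at `t`.
  have hGeq : t / x * Real.exp (-l + (1 / x - 1)) = l * t * Real.exp (1 - l * t) := by
    have h1 : l * t = l - x - 1 / x + 2 := by linear_combination -ht
    have h2 : Real.exp (-l + (1 / x - 1)) = l * x * Real.exp (1 - l * t) := by
      rw [hlx, ← Real.exp_add, h1]; congr 1; ring
    rw [h2]; field_simp
  have hG0 : 0 < l * t * Real.exp (1 - l * t) := by positivity
  have hGt : l * t * Real.exp (1 - l * t) ≤ t := by
    have h1 : l * Real.exp (1 - l * t) ≤ 1 := by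
      rw [← Real.exp_log hl, ← Real.exp_add, Real.exp_log hl, Real.exp_le_one_iff]
      linarith
    nlinarith
  refine mhrClass_optimal_of_plateau hw hl hx hx1 hrt hle hlt rfl (hGeq ▸ hGt) ?_ ?_
  · intro s _
    rw [hGeq]
    calc l * t * Real.exp (1 - l * t) * s * Real.exp (-(l * s))
        = t * Real.exp (1 - l * t) * (l * s * Real.exp (-(l * s))) := by ring
      _ ≤ t * Real.exp (1 - l * t) * Real.exp (-1) := by
          gcongr; exact mul_mul_exp_neg_le s
      _ = t * Real.exp (-(l * t)) := by rw [mul_assoc, ← Real.exp_add]; congr 2; ring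
  · intro t' ht' htt
    rw [hGeq]
    refine (guarantee_mhrClass_le_of_exponential hw hl hl1.le ht'
      (htt.le.trans ht1)).trans_lt ((ENNReal.ofReal_lt_ofReal_iff hG0).2 ?_)
    exact mul_exp_one_sub_lt (by positivity) (by gcongr) (by nlinarith)

end Pricing

/-! ### The Lambert function and the threshold between the first two mhr regimes -/

namespace Pricing

theorem lambertW_pos {y : ℝ} (hy : 0 < y) : 0 < lambertW y := by
  obtain ⟨h1, h2⟩ := lambertW_spec hy.le
  refine h1.lt_of_ne fun h => ?_
  rw [← h, zero_mul] at h2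
  exact hy.ne h2

theorem log_lambertW_add {y : ℝ} (hy : 0 < y) :
    Real.log (lambertW y) + lambertW y = Real.log y := by
  have h1 := lambertW_pos hy
  conv_rhs => rw [← (lambertW_spec hy.le).2]
  rw [Real.log_mul h1.ne' (Real.exp_pos _).ne', Real.log_exp]

theorem log_add_self_lt_iff {a b : ℝ} (ha : 0 < a) (hb : 0 < b) :
    Real.log a + a < Real.log b + b ↔ a < b := by
  have hmono : StrictMonoOn (fun x : ℝ => Real.log x + x) (Ioi 0) := fun x hx y _ hxy =>
    add_lt_add (Real.log_lt_log hx hxy) hxy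
  exact hmono.lt_iff_lt ha hb

/-- The function whose positive root governs the switch between the two interior regimes. -/
def switchFun (x : ℝ) : ℝ := x * Real.log x + Real.exp (-x) + x - 1

theorem switchFun_zero : switchFun 0 = 0 := by simp [switchFun]

theorem strictConvexOn_switchFun : StrictConvexOn ℝ (Ici 0) switchFun := by
  have h1 : ConvexOn ℝ (Ici 0) fun x : ℝ => Real.exp (-x) :=
    ((convexOn_exp.comp_linearMap (-LinearMap.id : ℝ →ₗ[ℝ] ℝ)).subset (subset_univ _)
      (convex_Ici 0))
  have h2 : ConvexOn ℝ (Ici 0) fun x : ℝ => x + (-1 : ℝ) :=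
    (convexOn_id (convex_Ici 0)).add_const _
  have h3 := (Real.strictConvexOn_mul_log.add_convexOn h1).add_convexOn h2
  refine h3.congr fun x _ => ?_
  simp only [Pi.add_apply, switchFun]
  ring

theorem continuous_switchFun : Continuous switchFun := by
  have := Real.continuous_mul_log
  unfold switchFun
  fun_prop

/-- Strict convexity and the value `0` at `0` make `switchFun x / x` strictly increasing on the
positive half-line, which is `key` with denominators cleared. -/
theorem switchFun_neg_iff {r x : ℝ} (hr : 0 < r) (hr0 : switchFun r = 0) (hx : 0 < x) :
    switchFun x < 0 ↔ x < r := by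
  have key : ∀ a b, 0 < a → a < b → switchFun a * b < switchFun b * a := by
    intro a b ha hab
    have hb : 0 < b := ha.trans hab
    have h := strictConvexOn_switchFun.2 (show (0 : ℝ) ∈ Ici 0 by simp)
      (show b ∈ Ici 0 from hb.le) hb.ne (sub_pos.2 ((div_lt_one hb).2 hab))
      (div_pos ha hb) (by ring)
    simp only [smul_eq_mul, mul_zero, zero_add, switchFun_zero, div_mul_cancel₀ _ hb.ne'] at h
    rwa [div_mul_eq_mul_div, lt_div_iff₀ hb, mul_comm a] at h
  constructor
  · intro h
    by_contra hle
    rcases (not_lt.1 hle).eq_or_lt with rfl | hlt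
    · exact h.ne hr0
    · have := key r x hr hlt
      rw [hr0, zero_mul] at this
      exact absurd this (not_lt.2 (mul_nonpos_of_nonpos_of_nonneg h.le hr.le))
  · intro h
    have := key x r hx h
    rw [hr0, zero_mul] at this
    exact neg_of_mul_neg_left this hr.le

theorem switchFun_pos_iff {r x : ℝ} (hr : 0 < r) (hr0 : switchFun r = 0) (hx : 0 < x) :
    0 < switchFun x ↔ r < x := by
  have h1 := switchFun_neg_iff hr hr0 hx
  constructor
  · intro h
    refine lt_of_le_of_ne (not_lt.1 fun h2 => lt_asymm h (h1.2 h2)) ?_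
    rintro rfl
    exact h.ne' hr0
  · intro h
    refine lt_of_le_of_ne (not_lt.1 fun h2 => lt_asymm h (h1.1 h2)) fun h3 => ?_
    have h4 := (switchFun_neg_iff hx h3.symm hr).2 h
    exact h4.ne hr0

/-- Taylor polynomial of degree 7; the remainder bound is `9 / (8! * 8) = 1 / 35840`. It drives all
numerical estimates of the threshold. -/
theorem exp_neg_bounds {x : ℝ} (hx : 0 ≤ x) (hx1 : x ≤ 1) :
    |Real.exp (-x) - (1 - x + x ^ 2 / 2 - x ^ 3 / 6 + x ^ 4 / 24 - x ^ 5 / 120 + x ^ 6 / 720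
      - x ^ 7 / 5040)| ≤ 1 / 35840 := by
  have h := Real.exp_bound (x := -x) (by rwa [abs_neg, abs_of_nonneg hx]) (n := 8) (by norm_num)
  have e : ∑ m ∈ Finset.range 8, (-x) ^ m / (m.factorial : ℝ) = 1 - x + x ^ 2 / 2 - x ^ 3 / 6 +
      x ^ 4 / 24 - x ^ 5 / 120 + x ^ 6 / 720 - x ^ 7 / 5040 := by
    simp only [Finset.sum_range_succ, Finset.sum_range_zero, Nat.factorial]
    push_cast
    ring
  rw [e, abs_neg, abs_of_nonneg hx] at h
  refine h.trans ?_
  have h2 : x ^ 8 ≤ 1 := pow_le_one₀ hx hx1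
  simp only [Nat.factorial]
  norm_num
  linarith

theorem exists_switchFun_root :
    ∃ r : ℝ, 0.74 ≤ r ∧ r ≤ 0.746 ∧ switchFun r = 0 := by
  have h1 : switchFun 0.74 ≤ 0 := by
    have e1 := abs_le.1 (exp_neg_bounds (x := 0.74) (by norm_num) (by norm_num))
    have e2 := abs_le.1 (exp_neg_bounds (x := 0.301) (by norm_num) (by norm_num))
    have e3 : Real.log 0.74 ≤ -0.301 := by
      rw [Real.log_le_iff_le_exp (by norm_num)]
      norm_num at e2 ⊢
      linarith
    unfold switchFun
    norm_num at e1 e3 ⊢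
    linarith
  have h2 : 0 ≤ switchFun 0.746 := by
    have e1 := abs_le.1 (exp_neg_bounds (x := 0.746) (by norm_num) (by norm_num))
    have e2 := abs_le.1 (exp_neg_bounds (x := 0.2931) (by norm_num) (by norm_num))
    have e3 : -0.2931 ≤ Real.log 0.746 := by
      rw [Real.le_log_iff_exp_le (by norm_num)]
      norm_num at e2 ⊢
      linarith
    unfold switchFun
    norm_num at e1 e3 ⊢
    linarith
  obtain ⟨r, hr, hr0⟩ := intermediate_value_Icc (by norm_num : (0.74 : ℝ) ≤ 0.746)
    continuous_switchFun.continuousOn ⟨h1, h2⟩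
  exact ⟨r, hr.1, hr.2, hr0⟩

theorem exp_neg_exp_neg_div_mem {r : ℝ} (h1 : 0.74 ≤ r) (h2 : r ≤ 0.746) :
    0.52 ≤ Real.exp (-(Real.exp (-r) / r)) ∧ Real.exp (-(Real.exp (-r) / r)) ≤ 0.53 := by
  have hr : 0 < r := by linarith
  have e1 := abs_le.1 (exp_neg_bounds (x := 37 / 50) (by norm_num) (by norm_num))
  have e2 := abs_le.1 (exp_neg_bounds (x := 373 / 500) (by norm_num) (by norm_num))
  have e3 := abs_le.1 (exp_neg_bounds (x := 6449 / 10000) (by norm_num) (by norm_num))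
  have e4 := abs_le.1 (exp_neg_bounds (x := 1589 / 2500) (by norm_num) (by norm_num))
  have m1 : Real.exp (-r) ≤ Real.exp (-(37 / 50)) := Real.exp_le_exp.2 (by linarith)
  have m2 : Real.exp (-(373 / 500)) ≤ Real.exp (-r) := Real.exp_le_exp.2 (by linarith)
  norm_num at e1 e2 e3 e4 h1 h2
  have u : Real.exp (-r) / r ≤ 6449 / 10000 := by
    rw [div_le_iff₀ hr]; linarith
  have l : 1589 / 2500 ≤ Real.exp (-r) / r := by
    rw [le_div_iff₀ hr]; linarith
  have m3 : Real.exp (-(6449 / 10000)) ≤ Real.exp (-(Real.exp (-r) / r)) :=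
    Real.exp_le_exp.2 (neg_le_neg u)
  have m4 : Real.exp (-(Real.exp (-r) / r)) ≤ Real.exp (-(1589 / 2500)) :=
    Real.exp_le_exp.2 (neg_le_neg l)
  norm_num
  constructor <;> linarith

theorem exp_neg_lambertW_div {l : ℝ} (hl : 0 < l) :
    Real.exp (-lambertW (1 / l)) / lambertW (1 / l) = l := by
  have hx := lambertW_pos (one_div_pos.2 hl)
  have h := (lambertW_spec (one_div_pos.2 hl).le).2
  rw [Real.exp_neg]
  rw [eq_div_iff hl.ne'] at h
  field_simp
  linarith

theorem exp_neg_div_lt_iff {a b : ℝ} (ha : 0 < a) (hb : 0 < b) :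
    Real.exp (-a) / a < Real.exp (-b) / b ↔ b < a := by
  have e : ∀ y, 0 < y → Real.exp (-y) / y = Real.exp (-(Real.log y + y)) := fun y hy => by
    rw [neg_add, Real.exp_add, Real.exp_neg (Real.log y), Real.exp_log hy]; field_simp
  rw [e _ ha, e _ hb, Real.exp_lt_exp, neg_lt_neg_iff, log_add_self_lt_iff hb ha]

/-- Comparison of `W (1 / l)` and `1 / W (e / q)` for `q = exp (-l)`. -/
theorem switchFun_lambertW {l : ℝ} (hl : 0 < l) :
    (1 / lambertW (1 / l) - Real.log (lambertW (1 / l))) - (1 + l)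
      = -switchFun (lambertW (1 / l)) / lambertW (1 / l) := by
  have hx := lambertW_pos (one_div_pos.2 hl)
  have h := exp_neg_lambertW_div hl
  generalize lambertW (1 / l) = x at hx h ⊢
  subst h
  rw [switchFun]
  field_simp
  ring

end Pricing

/-! ### The mhr regimes in terms of `q` -/

namespace Pricing

theorem log_one_div_pos {q : ℝ} (hq : 0 < q) (hq1 : q < 1) : 0 < Real.log (1 / q) :=
  Real.log_pos ((one_lt_div hq).2 hq1)

theorem exp_neg_log_one_div {q : ℝ} (hq : 0 < q) : Real.exp (-Real.log (1 / q)) = q := by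
  rw [one_div, Real.log_inv, neg_neg, Real.exp_log hq]

theorem log_lambertW_exp_one_div {q : ℝ} (hq : 0 < q) :
    Real.log (lambertW (Real.exp 1 / q)) + lambertW (Real.exp 1 / q) = 1 + Real.log (1 / q) := by
  rw [log_lambertW_add (by positivity), Real.log_div (Real.exp_pos _).ne' hq.ne', Real.log_exp,
    one_div, Real.log_inv]
  ring

theorem one_lt_lambertW_exp_one_div {q : ℝ} (hq : 0 < q) (hq1 : q < 1) :
    1 < lambertW (Real.exp 1 / q) := by
  rw [← log_add_self_lt_iff one_pos (lambertW_pos (by positivity)), log_lambertW_exp_one_div hq,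
    Real.log_one]
  linarith [log_one_div_pos hq hq1]

theorem log_mul_one_sub_lambertBeta {q : ℝ} (hq : 0 < q) (hq1 : q < 1) (y : ℝ) :
    Real.log (1 / q) * (1 - lambertBeta q y) = lambertW y + 1 / lambertW y - 2 := by
  have := log_one_div_pos hq hq1
  rw [lambertBeta]
  generalize Real.log (1 / q) = l at *
  field_simp
  ring

theorem log_one_div_lambertW_add {q : ℝ} (hq : 0 < q) (hq1 : q < 1) :
    Real.log (lambertW (1 / Real.log (1 / q))) + lambertW (1 / Real.log (1 / q))
      = -Real.log (Real.log (1 / q)) := by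
  rw [log_lambertW_add (one_div_pos.2 (log_one_div_pos hq hq1)), one_div (Real.log (1 / q)),
    Real.log_inv]

/-- With `x = W (1 / l)` and `u = W (e / q)`, the claim `u < 1 / x` is tested through the increasing
function `log y + y`, whose value at `u` is `1 + l`. As `l = exp (-x) / x`, only `x` remains. -/
theorem lambertW_mul_lambertW_lt_one_iff {q : ℝ} (hq : 0 < q) (hq1 : q < 1) :
    lambertW (1 / Real.log (1 / q)) * lambertW (Real.exp 1 / q) < 1 ↔
      switchFun (lambertW (1 / Real.log (1 / q))) < 0 := by
  have hl := log_one_div_pos hq hq1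
  have hx := lambertW_pos (one_div_pos.2 hl)
  have hu := lambertW_pos (y := Real.exp 1 / q) (by positivity)
  rw [mul_comm, ← lt_div_iff₀ hx, ← log_add_self_lt_iff hu (one_div_pos.2 hx),
    log_lambertW_exp_one_div hq, one_div (lambertW _), Real.log_inv]
  have h := switchFun_lambertW hl
  rw [one_div (lambertW _), eq_div_iff hx.ne'] at h
  generalize lambertW (1 / Real.log (1 / q)) = x at *
  constructor <;> intro h1
  · have := mul_pos (sub_pos.2 h1) hx
    linarith
  · have := (mul_pos_iff_of_pos_right hx).1 (h.symm ▸ neg_pos.2 h1)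
    linarith

theorem one_lt_lambertW_mul_lambertW_iff {q : ℝ} (hq : 0 < q) (hq1 : q < 1) :
    1 < lambertW (1 / Real.log (1 / q)) * lambertW (Real.exp 1 / q) ↔
      0 < switchFun (lambertW (1 / Real.log (1 / q))) := by
  have hl := log_one_div_pos hq hq1
  have hx := lambertW_pos (one_div_pos.2 hl)
  have hu := lambertW_pos (y := Real.exp 1 / q) (by positivity)
  rw [mul_comm, ← div_lt_iff₀ hx, ← log_add_self_lt_iff (one_div_pos.2 hx) hu,
    log_lambertW_exp_one_div hq, one_div (lambertW _), Real.log_inv]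
  have h := switchFun_lambertW hl
  rw [one_div (lambertW _), eq_div_iff hx.ne'] at h
  generalize lambertW (1 / Real.log (1 / q)) = x at *
  constructor <;> intro h1
  · have := mul_pos (sub_pos.2 h1) hx
    linarith
  · have := neg_of_mul_neg_left (h.trans_lt (neg_neg_of_pos h1)) hx.le
    linarith

section Switch

variable {r q : ℝ}

theorem lt_exp_neg_exp_neg_div_iff (hr : 0 < r) (hq : 0 < q) (hq1 : q < 1) :
    q < Real.exp (-(Real.exp (-r) / r)) ↔ lambertW (1 / Real.log (1 / q)) < r := by
  have hl := log_one_div_pos hq hq1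
  conv_lhs => rw [← exp_neg_log_one_div hq, ← exp_neg_lambertW_div hl]
  rw [Real.exp_lt_exp, neg_lt_neg_iff, exp_neg_div_lt_iff hr (lambertW_pos (one_div_pos.2 hl))]

theorem exp_neg_exp_neg_div_lt_iff (hr : 0 < r) (hq : 0 < q) (hq1 : q < 1) :
    Real.exp (-(Real.exp (-r) / r)) < q ↔ r < lambertW (1 / Real.log (1 / q)) := by
  have hl := log_one_div_pos hq hq1
  conv_lhs => rw [← exp_neg_log_one_div hq, ← exp_neg_lambertW_div hl]
  rw [Real.exp_lt_exp, neg_lt_neg_iff, exp_neg_div_lt_iff (lambertW_pos (one_div_pos.2 hl)) hr]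

theorem lambertW_mul_lambertW_le_one_iff (hr : 0 < r) (hr0 : switchFun r = 0) (hq : 0 < q)
    (hq1 : q < 1) : lambertW (1 / Real.log (1 / q)) * lambertW (Real.exp 1 / q) ≤ 1 ↔
      q ≤ Real.exp (-(Real.exp (-r) / r)) := by
  rw [← not_lt, ← not_lt, one_lt_lambertW_mul_lambertW_iff hq hq1,
    switchFun_pos_iff hr hr0 (lambertW_pos (one_div_pos.2 (log_one_div_pos hq hq1))),
    exp_neg_exp_neg_div_lt_iff hr hq hq1]

theorem one_le_lambertW_mul_lambertW_iff (hr : 0 < r) (hr0 : switchFun r = 0) (hq : 0 < q)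
    (hq1 : q < 1) : 1 ≤ lambertW (1 / Real.log (1 / q)) * lambertW (Real.exp 1 / q) ↔
      Real.exp (-(Real.exp (-r) / r)) ≤ q := by
  rw [← not_lt, ← not_lt, lambertW_mul_lambertW_lt_one_iff hq hq1,
    switchFun_neg_iff hr hr0 (lambertW_pos (one_div_pos.2 (log_one_div_pos hq hq1))),
    lt_exp_neg_exp_neg_div_iff hr hq hq1]

end Switch

variable {w q : ℝ}

theorem mhrClass_optimal_of_exp_le (hw : 0 < w) (hq : 0 < q) (hq1 : q < 1)
    (hle : Real.exp (-Real.exp (-1)) ≤ q) :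
    (∀ p : ℝ, IsOptimalPrice (mhrClass w {q}) p ↔ p = w) ∧
      maximinRatio deterministicMechanisms (mhrClass w {q}) =
        ENNReal.ofReal (Real.exp 1 * q * Real.log (1 / q)) := by
  have hq' := exp_neg_log_one_div hq
  have hle' : Real.log (1 / q) ≤ Real.exp (-1) := by
    rwa [← hq', Real.exp_le_exp, neg_le_neg_iff] at hle
  have := mhrClass_optimal_of_le_exp_neg_one hw (log_one_div_pos hq hq1) hle'
  rwa [hq'] at this

theorem mhrClass_optimal_of_lambertW_mul_le (hw : 0 < w) (hq : 0 < q) (hq1 : q < 1)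
    (hle : lambertW (1 / Real.log (1 / q)) * lambertW (Real.exp 1 / q) ≤ 1) :
    (∀ p : ℝ, IsOptimalPrice (mhrClass w {q}) p ↔ p = w * lambertBeta q (Real.exp 1 / q)) ∧
      maximinRatio deterministicMechanisms (mhrClass w {q}) =
        ENNReal.ofReal (lambertBeta q (Real.exp 1 / q)) := by
  have hl := log_one_div_pos hq hq1
  have hx := lambertW_pos (one_div_pos.2 hl)
  have hu1 := one_lt_lambertW_exp_one_div hq hq1
  have hu := one_pos.trans hu1
  have hlx := log_one_div_lambertW_add hq hq1
  have h := mhrClass_optimal_of_low hw hl hu1 (log_lambertW_exp_one_div hq)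
    (log_mul_one_sub_lambertBeta hq hq1 _) ?_
  · rwa [exp_neg_log_one_div hq] at h
  · have h1 : lambertW (1 / Real.log (1 / q)) ≤ 1 / lambertW (Real.exp 1 / q) :=
      (le_div_iff₀ hu).2 hle
    have h2 := Real.log_le_log hx h1
    rw [one_div (lambertW (Real.exp 1 / q)), Real.log_inv] at h2
    linarith

theorem mhrClass_optimal_of_le_lambertW_mul (hw : 0 < w) (hq : 0 < q) (hq1 : q < 1)
    (hq2 : 1 / 2 ≤ q) (hle : 1 ≤ lambertW (1 / Real.log (1 / q)) * lambertW (Real.exp 1 / q))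
    (hqe : q ≤ Real.exp (-Real.exp (-1))) :
    (∀ p : ℝ, IsOptimalPrice (mhrClass w {q}) p ↔
      p = w * lambertBeta q (1 / Real.log (1 / q))) ∧
      maximinRatio deterministicMechanisms (mhrClass w {q}) =
        ENNReal.ofReal (lambertBeta q (1 / Real.log (1 / q)) * (q / Real.exp 1) *
          (Real.exp (1 / lambertW (1 / Real.log (1 / q))) /
            lambertW (1 / Real.log (1 / q)))) := by
  have hl := log_one_div_pos hq hq1
  have hx := lambertW_pos (one_div_pos.2 hl)
  have hlx := log_one_div_lambertW_add hq hq1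
  have hq' := exp_neg_log_one_div hq
  -- At the right endpoint `W (1 / l) = 1` and the plateau degenerates. The formulas reduce to those
  -- of the last regime, which covers this case.
  rcases hqe.eq_or_lt with heq | hlt
  · have hlog : Real.log (1 / q) = Real.exp (-1) := by
      rw [← neg_inj, ← Real.exp_eq_exp, hq', heq]
    have hW : lambertW (1 / Real.log (1 / q)) = 1 := by
      have h1 : (1 : ℝ) / Real.log (1 / q) = 1 * Real.exp 1 := by
        rw [hlog, Real.exp_neg, one_div, inv_inv, one_mul]
      rw [h1, lambertW_mul_exp zero_le_one]
    have hβ : lambertBeta q (1 / Real.log (1 / q)) = 1 := by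
      rw [lambertBeta, hW]; norm_num
    have h := mhrClass_optimal_of_exp_le hw hq hq1 heq.ge
    rw [hβ, hW, mul_one, one_mul, div_one, div_one, div_mul_cancel₀ _ (Real.exp_pos _).ne']
    rw [hlog, mul_right_comm, ← Real.exp_add, add_neg_cancel, Real.exp_zero, one_mul] at h
    exact h
  · have hl1 : Real.log (1 / q) < 1 := by
      rw [← neg_lt_neg_iff, ← Real.exp_lt_exp, hq']
      exact Real.exp_neg_one_lt_half.trans_le hq2
    have hle1 : Real.exp (-1) < Real.log (1 / q) := by
      rwa [← neg_lt_neg_iff, ← Real.exp_lt_exp, hq']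
    have hx1 : lambertW (1 / Real.log (1 / q)) < 1 := by
      rw [← log_add_self_lt_iff hx one_pos, hlx, Real.log_one]
      have := Real.log_lt_log (Real.exp_pos _) hle1
      rw [Real.log_exp] at this
      linarith
    have h := mhrClass_optimal_of_mid hw hl hl1 hx hx1 hlx
      (log_mul_one_sub_lambertBeta hq hq1 _) ?_
    · have e : lambertBeta q (1 / Real.log (1 / q)) / lambertW (1 / Real.log (1 / q)) *
          Real.exp (-Real.log (1 / q) + (1 / lambertW (1 / Real.log (1 / q)) - 1))
          = lambertBeta q (1 / Real.log (1 / q)) * (q / Real.exp 1) *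
          (Real.exp (1 / lambertW (1 / Real.log (1 / q))) /
            lambertW (1 / Real.log (1 / q))) := by
        rw [Real.exp_add, hq', Real.exp_sub]
        ring
      rwa [hq', e] at h
    · rw [← not_lt, lambertW_mul_lambertW_lt_one_iff hq hq1, not_lt] at hle
      have h1 := switchFun_lambertW hl
      have h2 : -switchFun (lambertW (1 / Real.log (1 / q))) / lambertW (1 / Real.log (1 / q)) ≤ 0 :=
        div_nonpos_of_nonpos_of_nonneg (by linarith) hx.le
      linarith

end Pricing

end

theorem theorem2 :
    -- regular distributions
    (∀ w q : ℝ, 0 < w → 0 < q → q < 1 →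
      (q ≤ 1 / 4 →
        (∀ p : ℝ, Pricing.IsOptimalPrice (Pricing.regularClass w {q}) p ↔
          p = w * (2 * √q) / (1 + √q)) ∧
        Pricing.maximinRatio Pricing.deterministicMechanisms (Pricing.regularClass w {q}) =
          ENNReal.ofReal (2 * √q / (1 + √q))) ∧
      (1 / 4 ≤ q → q ≤ 1 / 2 →
        (∀ p : ℝ, Pricing.IsOptimalPrice (Pricing.regularClass w {q}) p ↔
          p = w * q * (3 - 4 * q) / (1 - q)) ∧
        Pricing.maximinRatio Pricing.deterministicMechanisms (Pricing.regularClass w {q}) =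
          ENNReal.ofReal ((3 - 4 * q) / (4 * (1 - q)))) ∧
      (1 / 2 ≤ q →
        (∀ p : ℝ, Pricing.IsOptimalPrice (Pricing.regularClass w {q}) p ↔ p = w) ∧
        Pricing.maximinRatio Pricing.deterministicMechanisms (Pricing.regularClass w {q}) =
          ENNReal.ofReal (1 - q))) ∧
    -- monotone hazard rate distributions
    (∃ qhat : ℝ, 0.52 ≤ qhat ∧ qhat ≤ 0.53 ∧
      (∀ q : ℝ, 0 < q → q < 1 →
        (Pricing.lambertW (1 / Real.log (1 / q)) * Pricing.lambertW (Real.exp 1 / q) = 1 ↔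
          q = qhat)) ∧
      ∀ w q : ℝ, 0 < w → 0 < q → q < 1 →
        (q ≤ qhat →
          (∀ p : ℝ, Pricing.IsOptimalPrice (Pricing.mhrClass w {q}) p ↔
            p = w * Pricing.lambertBeta q (Real.exp 1 / q)) ∧
          Pricing.maximinRatio Pricing.deterministicMechanisms (Pricing.mhrClass w {q}) =
            ENNReal.ofReal (Pricing.lambertBeta q (Real.exp 1 / q))) ∧
        (qhat ≤ q → q ≤ Real.exp (-Real.exp (-1)) →
          (∀ p : ℝ, Pricing.IsOptimalPrice (Pricing.mhrClass w {q}) p ↔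
            p = w * Pricing.lambertBeta q (1 / Real.log (1 / q))) ∧
          Pricing.maximinRatio Pricing.deterministicMechanisms (Pricing.mhrClass w {q}) =
            ENNReal.ofReal (Pricing.lambertBeta q (1 / Real.log (1 / q)) * (q / Real.exp 1) *
              (Real.exp (1 / Pricing.lambertW (1 / Real.log (1 / q))) /
                Pricing.lambertW (1 / Real.log (1 / q))))) ∧
        (Real.exp (-Real.exp (-1)) ≤ q →
          (∀ p : ℝ, Pricing.IsOptimalPrice (Pricing.mhrClass w {q}) p ↔ p = w) ∧
          Pricing.maximinRatio Pricing.deterministicMechanisms (Pricing.mhrClass w {q}) =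
            ENNReal.ofReal (Real.exp 1 * q * Real.log (1 / q)))) := by
  refine ⟨fun w q hw hq hq1 => ⟨Pricing.regularClass_optimal_of_le_quarter hw hq,
    fun h4 h2 => ?_, fun h2 => Pricing.regularClass_optimal_of_half_le hw h2 hq1⟩, ?_⟩
  · rcases h2.lt_or_eq with h2 | rfl
    · exact Pricing.regularClass_optimal_of_lt_half hw h4 h2
    -- At `q = 1 / 2` the formulas of the second and third regimes agree.
    · have h := Pricing.regularClass_optimal_of_half_le hw le_rfl hq1
      rw [show w * (1 / 2) * (3 - 4 * (1 / 2)) / (1 - 1 / 2) = w by ring,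
        show ((3 : ℝ) - 4 * (1 / 2)) / (4 * (1 - 1 / 2)) = 1 - 1 / 2 by norm_num]
      exact h
  · obtain ⟨r, h1, h2, hr0⟩ := Pricing.exists_switchFun_root
    have hr : 0 < r := by linarith
    obtain ⟨hlo, hhi⟩ := Pricing.exp_neg_exp_neg_div_mem h1 h2
    -- The threshold is the `q` with `W (1 / l) = r`, that is `l = exp (-r) / r`, for the positive
    -- root `r` of `switchFun`.
    refine ⟨Real.exp (-(Real.exp (-r) / r)), hlo, hhi, fun q hq hq1 => ?_, fun w q hw hq hq1 =>
      ⟨fun h => ?_, fun h h' => ?_, Pricing.mhrClass_optimal_of_exp_le hw hq hq1⟩⟩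
    · rw [le_antisymm_iff, le_antisymm_iff,
        Pricing.lambertW_mul_lambertW_le_one_iff hr hr0 hq hq1,
        Pricing.one_le_lambertW_mul_lambertW_iff hr hr0 hq hq1]
    · exact Pricing.mhrClass_optimal_of_lambertW_mul_le hw hq hq1
        ((Pricing.lambertW_mul_lambertW_le_one_iff hr hr0 hq hq1).2 h)
    · exact Pricing.mhrClass_optimal_of_le_lambertW_mul hw hq hq1 (by norm_num at hlo ⊢; linarith)
        ((Pricing.one_le_lambertW_mul_lambertW_iff hr hr0 hq hq1).2 h) h'
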